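/- Let $p$ be an odd prime, let $\mathbb{F}$ be an algebraically closed field of characteristic $p$, let $G = SL_2(\mathbb{F}_p)$ and let $B \le G$ be the subgroup of upper triangular matrices. All modules are right modules. Let $\zeta$ be a primitive root modulo $p$, and put $g = \begin{pmatrix}1&1\\0&1\end{pmatrix}$ and $\lambda = \begin{pmatrix}\zeta&0\\0&\zeta^{-1}\end{pmatrix}$, which generate $B$. For $a \in \mathbb{Z}$ let $S_a$ be the one-dimensional $\mathbb{F}[B]$-module on which $g$ acts trivially and $\lambda$ acts as multiplication by $\zeta^a$. For $1 \le b \le p$ let $U_{a,b}$ be the (unique up to isomorphism) uniserial $\mathbb{F}[B]$-module of dimension $b$ whose composition factors, in ascending order (from the socle to the top), are $S_a, S_{a+2}, \dots, S_{a+2(b-1)}$. For $1 \le t \le p$ let $V_t \subseteq \mathbb{F}[x,y]$ be the simple $\mathbb{F}[G]$-module of homogeneous polynomials of degree $t-1$, spanned by $x^{t-1}, x^{t-2}y, \dots, y^{t-1}$, with the action $$x^i y^j \cdot \begin{pmatrix}\alpha&\beta\\ \gamma&\delta\end{pmatrix} = (\alpha x+\beta y)^i(\gamma x+\delta y)^j,$$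 and let $P_{V_t}$ be its projective cover, that is, a projective $\mathbb{F}[G]$-module with an epimorphism onto $V_t$ whose kernel is superfluous (it exists and is unique up to isomorphism). Then, for every $1 \le t \le p$, as $\mathbb{F}[B]$-modules, $$\mathrm{Res}^G_B(P_{V_t}) \cong \begin{cases} U_{0,p} & \text{if } t \in \{1,p\},\\ U_{t-1,p}\oplus U_{p-t,p} & \text{if } 1<t<p.\end{cases}$$ -/

import Mathlib

universe u v w

open Matrix MulOpposite

namespace SL2Rep

noncomputable section

/-- The group `G = SL₂(𝔽_p)`. -/
abbrev G (p : ℕ) : Type := Matrix.SpecialLinearGroup (Fin 2) (ZMod p)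

/-- The subgroup `B` of upper triangular matrices of `G`. -/
def B (p : ℕ) : Subgroup (G p) where
  carrier := {A | A.1 1 0 = 0}
  one_mem' := by simp
  mul_mem' := by
    intro A A' h h'
    simp only [Set.mem_ofPred_eq] at h h' ⊢
    simp [Matrix.mul_apply, Fin.sum_univ_two, h, h']
  inv_mem' := by
    intro A h
    simp only [Set.mem_ofPred_eq] at h ⊢
    simp [Matrix.SpecialLinearGroup.coe_inv, Matrix.adjugate_fin_two, h]

/-- The generator `g = (1 1; 0 1)` of the group of upper unitriangular matrices. -/
def g (p : ℕ) : B p :=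
  ⟨⟨!![1, 1; 0, 1], by simp [Matrix.det_fin_two]⟩, rfl⟩

/-- The diagonal matrix `λ = diag(ζ, ζ⁻¹)`. -/
def lam {p : ℕ} (ζ : (ZMod p)ˣ) : B p :=
  ⟨⟨!![(ζ : ZMod p), 0; 0, ((ζ⁻¹ : (ZMod p)ˣ) : ZMod p)], by simp [Matrix.det_fin_two]⟩,
    rfl⟩

/-! Modules are right modules: a right `F[H]`-module is a representation of the opposite group
`Hᵐᵒᵖ`, in which `op h` acts as `v ↦ v · h`. Its group algebra `F[Hᵐᵒᵖ]` is the opposite ring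
of `F[H]`. -/

/-- Restriction of right modules from `G` to `B`. -/
def res {p : ℕ} {F M : Type*} [Field F] [AddCommGroup M] [Module F M]
    (ρ : Representation F (G p)ᵐᵒᵖ M) : Representation F (B p)ᵐᵒᵖ M :=
  ρ.comp (MonoidHom.op (B p).subtype)

/-- The algebra endomorphism of `F[x, y]`, with `x = X 0` and `y = X 1`, given by the substitution
`x ↦ α x + β y`, `y ↦ γ x + δ y` for a matrix `(α β; γ δ)` in `G`. -/
def subst {p : ℕ} (F : Type*) [Field F] [CharP F p] (A : G p) :
    MvPolynomial (Fin 2) F →ₐ[F] MvPolynomial (Fin 2) F :=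
  MvPolynomial.aeval fun i : Fin 2 =>
    ∑ j, MvPolynomial.C (ZMod.castHom (dvd_refl p) F (A.1 i j)) * MvPolynomial.X j

theorem subst_X {p : ℕ} (F : Type*) [Field F] [CharP F p] (A : G p) (i : Fin 2) :
    subst F A (MvPolynomial.X i) =
      ∑ j, MvPolynomial.C (ZMod.castHom (dvd_refl p) F (A.1 i j)) * MvPolynomial.X j := by
  simp only [subst, MvPolynomial.aeval_X]

theorem subst_one {p : ℕ} (F : Type*) [Field F] [CharP F p] :
    subst F (1 : G p) = AlgHom.id F _ := by
  apply MvPolynomial.algHom_ext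
  intro i
  rw [subst_X]
  fin_cases i <;> simp [Fin.sum_univ_two]

theorem subst_mul {p : ℕ} (F : Type*) [Field F] [CharP F p] (A A' : G p) :
    subst F (A * A') = (subst F A').comp (subst F A) := by
  apply MvPolynomial.algHom_ext
  intro i
  have hC : ∀ (D : G p) (c : F), subst F D (MvPolynomial.C c) = MvPolynomial.C c :=
    fun D c => MvPolynomial.algHom_C _ _
  rw [AlgHom.comp_apply, subst_X, subst_X]
  simp only [Fin.sum_univ_two, map_add, map_mul, hC, subst_X,
    Matrix.SpecialLinearGroup.coe_mul, Matrix.mul_apply]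
  ring

theorem subst_isHomogeneous {p : ℕ} (F : Type*) [Field F] [CharP F p] (A : G p) {n : ℕ}
    {f : MvPolynomial (Fin 2) F} (hf : f.IsHomogeneous n) : (subst F A f).IsHomogeneous n := by
  have := hf.aeval (S := F) (n := 1) (fun i : Fin 2 =>
    ∑ j, MvPolynomial.C (ZMod.castHom (dvd_refl p) F (A.1 i j)) * MvPolynomial.X j) (fun i =>
      MvPolynomial.IsHomogeneous.sum _ _ _ fun j _ => by
        simpa only [zero_add] using (MvPolynomial.isHomogeneous_C (Fin 2) _).mul
          (MvPolynomial.isHomogeneous_X F j))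
  rwa [one_mul] at this

/-- The right action of `G` on `F[x, y]` by substitution,
`x^i y^j · (α β; γ δ) = (α x + β y)^i (γ x + δ y)^j`. -/
def polyRep (p : ℕ) (F : Type*) [Field F] [CharP F p] :
    Representation F (G p)ᵐᵒᵖ (MvPolynomial (Fin 2) F) where
  toFun A := (subst F A.unop).toLinearMap
  map_one' := by
    rw [unop_one, subst_one]
    rfl
  map_mul' A A' := by
    rw [unop_mul, subst_mul]
    rfl

/-- The space of homogeneous polynomials of degree `t - 1`, that is, the span of
`x^(t-1), x^(t-2) y, …, y^(t-1)`, as a right `F[G]`-submodule of `F[x, y]`. -/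
def VSub (p : ℕ) (F : Type*) [Field F] [CharP F p] (t : ℕ) :
    Subrepresentation (polyRep p F) where
  toSubmodule := MvPolynomial.homogeneousSubmodule (Fin 2) F (t - 1)
  apply_mem_toSubmodule A _ hf := subst_isHomogeneous F A.unop hf

/-- The module `V_t`. -/
def V (p : ℕ) (F : Type*) [Field F] [CharP F p] (t : ℕ) :
    Representation F (G p)ᵐᵒᵖ (VSub p F t).toSubmodule :=
  (VSub p F t).toRepresentation

/-- `σ` is a projective cover of `ρ`: it is projective and has an epimorphism onto `ρ` whose
kernel is superfluous. -/
def IsProjectiveCover {F H P M : Type*} [Field F] [Group H] [AddCommGroup P] [Module F P]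
    [AddCommGroup M] [Module F M] (σ : Representation F H P) (ρ : Representation F H M) : Prop :=
  Module.Projective (MonoidAlgebra F H) σ.asModule ∧
    ∃ π : σ.IntertwiningMap ρ, Function.Surjective π ∧
      ∀ N : Subrepresentation σ, N ⊔ π.ker = ⊤ → N = ⊤

/-- The subquotient `N₂ / (N₁ ∩ N₂)`, which is `N₂ / N₁` for `N₁ ≤ N₂`. -/
def subquotient {F H M : Type*} [Field F] [Group H] [AddCommGroup M] [Module F M]
    {ρ : Representation F H M} (N₁ N₂ : Subrepresentation ρ) :
    Representation F H (N₂.toSubmodule ⧸ N₁.toSubmodule.comap N₂.toSubmodule.subtype) :=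
  N₂.toRepresentation.quotient (N₁.toSubmodule.comap N₂.toSubmodule.subtype)
    fun h _ hv => N₁.apply_mem_toSubmodule h hv

/-- The module is the simple `F[B]`-module `S_a`: it has dimension one, `g` acts trivially and `λ`
acts as multiplication by `ζ ^ a`. -/
def IsS {p : ℕ} {F M : Type*} [Field F] [CharP F p] [AddCommGroup M] [Module F M]
    (ζ : (ZMod p)ˣ) (a : ℤ) (ρ : Representation F (B p)ᵐᵒᵖ M) : Prop :=
  Module.finrank F M = 1 ∧ (∀ v, ρ (op (g p)) v = v) ∧
    ∀ v, ρ (op (lam ζ)) v = (ZMod.castHom (dvd_refl p) F (ζ : ZMod p)) ^ a • v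

/-- A module is uniserial if its submodules form a chain. -/
def IsUniserial {F H M : Type*} [Field F] [Group H] [AddCommGroup M] [Module F M]
    (ρ : Representation F H M) : Prop :=
  ∀ N₁ N₂ : Subrepresentation ρ, N₁ ≤ N₂ ∨ N₂ ≤ N₁

/-- The module is `U_{a,b}`: it is uniserial of dimension `b`, and it has a composition series
with factors `S_a, S_{a+2}, …, S_{a+2(b-1)}`, from the bottom to the top. -/
def IsU {p : ℕ} {F M : Type*} [Field F] [CharP F p] [AddCommGroup M] [Module F M]
    (ζ : (ZMod p)ˣ) (a : ℤ) (b : ℕ) (ρ : Representation F (B p)ᵐᵒᵖ M) : Prop :=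
  IsUniserial ρ ∧ Module.finrank F M = b ∧
    ∃ W : Fin (b + 1) → Subrepresentation ρ, W 0 = ⊥ ∧ W (Fin.last b) = ⊤ ∧
      ∀ i : Fin b, W i.castSucc ≤ W i.succ ∧
        IsS ζ (a + 2 * (i : ℕ)) (subquotient (W i.castSucc) (W i.succ))

end

end SL2Rep

/-! Let `P` be the projective cover of `V_t`. Linear forms on `P` fixed by `g` correspond to
`G`-maps from `P` to the functions on `𝔽_p²` vanishing at the origin, because `g` generates the
stabilizer of `(1, 0)`. These functions split into the spaces of functions homogeneous of degree `d`
for `0 ≤ d < p - 1`, and each of these is an extension of `V_{p-d}` by `V_{d+1}`: restrict forms of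
degree `d` to `𝔽_p²`, and send `f` to `∑ f(w) (w₀ y - w₁ x)^{p-d-1}`. As `P` maps onto no other
simple module than `V_t`, the forms fixed by `g` are spanned by one of degree `t - 1` (if `t < p`)
and one of degree `p - t` (if `t > 1`). Since `(g - 1)^p = 0` on `P`, its dimension is at most `p`
times the number of these forms.

Each of the forms is a `B`-map from `P` to the simple top of `U_{t-1,p}` or `U_{p-t,p}`. As the
restriction of `P` to `B` is projective, these maps lift to the direct sum of these modules; the
lift is surjective because the kernel of the projection to the tops is superfluous, and bijective
by the bound on the dimension. -/

namespace SL2Rep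

open Representation

noncomputable section

section ProjectiveCovers

variable {F H K P M N : Type*} [Field F] [Group H] [Group K]
  [AddCommGroup P] [Module F P] [AddCommGroup M] [Module F M] [AddCommGroup N] [Module F N]
  {σ : Representation F H P} {ρ : Representation F H M} {τ : Representation F H N}

/-- The inclusion of a subrepresentation, as an intertwining map. -/
def inclusionMap (X : Subrepresentation σ) : X.toRepresentation.IntertwiningMap σ where
  __ := X.toSubmodule.subtype
  isIntertwining' _ := rfl

/-- An essential epimorphism: a surjection whose kernel is superfluous. A projective cover is an
essential epimorphism with projective source. -/
def IsEssentialEpi (π : σ.IntertwiningMap ρ) : Prop :=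
  Function.Surjective π ∧ ∀ X : Subrepresentation σ, X ⊔ π.ker = ⊤ → X = ⊤

theorem sup_ker_eq_top_iff {π : σ.IntertwiningMap ρ} (hπ : Function.Surjective π)
    (X : Subrepresentation σ) :
    X ⊔ π.ker = ⊤ ↔ Function.Surjective (π.comp (inclusionMap X)) := by
  constructor
  · intro h w
    obtain ⟨v, rfl⟩ := hπ w
    have hv : v ∈ (X ⊔ π.ker).toSubmodule := by rw [h]; trivial
    obtain ⟨x, hx, k, hk : π k = 0, rfl⟩ := Submodule.mem_sup.mp hv
    exact ⟨⟨x, hx⟩, by rw [map_add, hk, add_zero]; rfl⟩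
  · intro h
    refine top_unique fun v _ ↦ ?_
    obtain ⟨x, hx : π x = π v⟩ := h (π v)
    exact Submodule.mem_sup.mpr
      ⟨x, x.2, v - x, show π (v - x) = 0 by rw [map_sub, hx, sub_self], by abel⟩

theorem IsEssentialEpi.surjective_of_comp {π : σ.IntertwiningMap ρ} (hπ : IsEssentialEpi π)
    {f : τ.IntertwiningMap σ} (hf : Function.Surjective (π.comp f)) : Function.Surjective f := by
  have hrange : f.range = ⊤ := hπ.2 _ <| (sup_ker_eq_top_iff hπ.1 _).mpr fun w ↦ by
    obtain ⟨v, rfl⟩ := hf w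
    exact ⟨⟨f v, v, rfl⟩, rfl⟩
  exact LinearMap.range_eq_top.mp (congrArg Subrepresentation.toSubmodule hrange)

theorem sup_ker_eq_top_of_not_le [ρ.IsIrreducible] (π : σ.IntertwiningMap ρ)
    {X : Subrepresentation σ} (hX : ¬ X ≤ π.ker) : X ⊔ π.ker = ⊤ := by
  have hne : π.comp (inclusionMap X) ≠ 0 := fun h ↦
    hX fun x hx ↦ congrArg (fun f : X.toRepresentation.IntertwiningMap ρ ↦ f ⟨x, hx⟩) h
  have hsurj := (IsIrreducible.surjective_or_eq_zero (π.comp (inclusionMap X))).resolve_right hne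
  have hπ : Function.Surjective π := .of_comp (g := inclusionMap X) hsurj
  exact (sup_ker_eq_top_iff hπ X).mpr hsurj

theorem IsEssentialEpi.ker_eq_ker_of_ne_zero [ρ.IsIrreducible] [τ.IsIrreducible]
    {π : σ.IntertwiningMap ρ} (hπ : IsEssentialEpi π) {ψ : σ.IntertwiningMap τ} (hψ : ψ ≠ 0) :
    ψ.ker = π.ker := by
  have hψ_ker : ψ.ker ≠ ⊤ := fun h ↦ hψ <| IntertwiningMap.ext <|
    LinearMap.ker_eq_top.mp (congrArg Subrepresentation.toSubmodule h)
  apply le_antisymm <;> by_contra hle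
  · exact hψ_ker (hπ.2 _ (sup_ker_eq_top_of_not_le π hle))
  · exact hψ_ker (hπ.2 _ (sup_comm π.ker ψ.ker ▸ sup_ker_eq_top_of_not_le ψ hle))

theorem IsEssentialEpi.finrank_eq_of_ne_zero [ρ.IsIrreducible] [τ.IsIrreducible]
    {π : σ.IntertwiningMap ρ} (hπ : IsEssentialEpi π) {ψ : σ.IntertwiningMap τ} (hψ : ψ ≠ 0) :
    Module.finrank F N = Module.finrank F M := by
  have hker : LinearMap.ker ψ.toLinearMap = LinearMap.ker π.toLinearMap :=
    congrArg Subrepresentation.toSubmodule (hπ.ker_eq_ker_of_ne_zero hψ)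
  have hψ_surj := (IsIrreducible.surjective_or_eq_zero ψ).resolve_right hψ
  exact (LinearEquiv.finrank_eq ((LinearMap.quotKerEquivOfSurjective _ hψ_surj).symm ≪≫ₗ
    Submodule.quotEquivOfEq _ _ hker ≪≫ₗ LinearMap.quotKerEquivOfSurjective _ hπ.1))

theorem exists_ne_zero_of_isIrreducible (ρ : Representation F H M) [ρ.IsIrreducible] :
    ∃ w : M, w ≠ 0 := by
  by_contra! h
  exact bot_ne_top (α := Subrepresentation ρ) (le_antisymm bot_le fun w _ ↦ h w)

theorem surjective_of_apply_ne_zero [ρ.IsIrreducible] (f : σ.IntertwiningMap ρ) {v : P}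
    (hv : f v ≠ 0) : Function.Surjective f :=
  (IsIrreducible.surjective_or_eq_zero f).resolve_right fun h ↦ hv (by rw [h]; rfl)

theorem IsUniserial.isEssentialEpi [Nontrivial N] (hρ : IsUniserial ρ) {f : ρ.IntertwiningMap τ}
    (hf : Function.Surjective f) : IsEssentialEpi f := by
  refine ⟨hf, fun X hX ↦ ?_⟩
  rcases hρ X f.ker with hle | hle
  · rw [sup_eq_right.mpr hle] at hX
    obtain ⟨w, hw⟩ := exists_ne (0 : N)
    obtain ⟨v, rfl⟩ := hf w
    exact absurd (show v ∈ f.ker by rw [hX]; trivial) hw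
  · rwa [sup_eq_left.mpr hle] at hX

/-- The projection onto the last factor of a filtration ending with the whole module. -/
def subquotientMk (N₁ : Subrepresentation ρ) {N₂ : Subrepresentation ρ} (h : N₂ = ⊤) :
    ρ.IntertwiningMap (subquotient N₁ N₂) where
  toLinearMap := Submodule.mkQ _ ∘ₗ
    LinearMap.id.codRestrict N₂.toSubmodule fun v ↦ (h ▸ trivial : v ∈ N₂)
  isIntertwining' _ := rfl

theorem leftRegularMapEquiv_symm_one (ρ : Representation F H M) (w : M) :
    (leftRegularMapEquiv ρ).symm w (.single 1 1) = w := by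
  rw [leftRegularMapEquiv_symm_single, map_one, Module.End.one_apply]

theorem IsEssentialEpi.finite [Finite H] [ρ.IsIrreducible] {π : σ.IntertwiningMap ρ}
    (hπ : IsEssentialEpi π) : Module.Finite F P := by
  obtain ⟨w, hw⟩ := exists_ne_zero_of_isIrreducible ρ
  obtain ⟨v, rfl⟩ := hπ.1 w
  have hf : Function.Surjective ((leftRegularMapEquiv σ).symm v) := by
    refine hπ.surjective_of_comp (surjective_of_apply_ne_zero _ (v := .single 1 1) ?_)
    rwa [IntertwiningMap.comp_apply, leftRegularMapEquiv_symm_one]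
  have : Module.Finite F (MonoidAlgebra F H) := .of_basis (MonoidAlgebra.basis H F)
  exact Module.Finite.of_surjective _ hf

theorem exists_lift (hσ : Module.Projective (MonoidAlgebra F H) σ.asModule)
    (f : ρ.IntertwiningMap τ) (hf : Function.Surjective f) (h : σ.IntertwiningMap τ) :
    ∃ k : σ.IntertwiningMap ρ, ∀ v, f (k v) = h v := by
  obtain ⟨k, hk⟩ := Module.projective_lifting_property
    (IntertwiningMap.equivLinearMapAsModule ρ τ f)
    (IntertwiningMap.equivLinearMapAsModule σ τ h) hf
  exact ⟨(IntertwiningMap.equivLinearMapAsModule σ ρ).symm k, LinearMap.congr_fun hk⟩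

theorem exists_comp_eq_of_injective {f : ρ.IntertwiningMap τ} (hf : Function.Injective f)
    (h : σ.IntertwiningMap τ) (hh : ∀ v, ∃ w, f w = h v) :
    ∃ k : σ.IntertwiningMap ρ, f.comp k = h := by
  choose k hk using hh
  refine ⟨{ toFun := k, map_add' := fun v v' ↦ hf ?_, map_smul' := fun c v ↦ hf ?_,
            isIntertwining' := fun x ↦ LinearMap.ext fun v ↦ hf ?_ },
    IntertwiningMap.ext (LinearMap.ext hk)⟩
  · rw [map_add, hk, hk, hk, map_add]
  · rw [RingHom.id_apply, map_smul, hk, hk, map_smul]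
  · change f (k (σ x v)) = f (ρ x (k v))
    rw [hk, h.isIntertwining _ _, f.isIntertwining _ _, hk]

theorem projective_of_comp_bijective (hσ : Module.Projective (MonoidAlgebra F H) σ.asModule)
    {i : ρ.IntertwiningMap σ} {k : σ.IntertwiningMap ρ} (hki : Function.Bijective (k.comp i)) :
    Module.Projective (MonoidAlgebra F H) ρ.asModule := by
  let e := IntertwiningMap.ofBijective (k.comp i) hki
  refine .of_split (IntertwiningMap.equivLinearMapAsModule ρ σ i)
    (IntertwiningMap.equivLinearMapAsModule σ ρ (e.symm.toIntertwiningMap.comp k)) ?_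
  exact LinearMap.ext fun v ↦ e.symm_apply_apply v

theorem exists_isEssentialEpi_restrict [Module.Finite F P] (f : σ.IntertwiningMap τ)
    (hf : Function.Surjective f) :
    ∃ Q : Subrepresentation σ, IsEssentialEpi (f.comp (inclusionMap Q)) := by
  have : WellFoundedLT (Subrepresentation σ) :=
    StrictMono.wellFoundedLT (f := Subrepresentation.toSubmodule) fun _ _ h ↦ h
  obtain ⟨Q, hQ, hmin⟩ := exists_minimal_of_wellFoundedLT
    (fun Q : Subrepresentation σ ↦ Function.Surjective (f.comp (inclusionMap Q)))
    ⟨⊤, (sup_ker_eq_top_iff hf ⊤).mp (top_sup_eq _)⟩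
  refine ⟨Q, hQ, fun X hX ↦ top_unique fun q _ ↦ ?_⟩
  let Q' : Subrepresentation σ := ((inclusionMap Q).comp (inclusionMap X)).range
  have hQ' : Function.Surjective (f.comp (inclusionMap Q')) := fun w ↦ by
    obtain ⟨x, rfl⟩ := (sup_ker_eq_top_iff hQ X).mp hX w
    exact ⟨⟨x, x, rfl⟩, rfl⟩
  have hle : Q' ≤ Q := by
    rintro _ ⟨x, rfl⟩
    exact x.1.2
  obtain ⟨x, hx⟩ := hmin hQ' hle q.2
  exact (Subtype.ext hx : (x : Q.toSubmodule) = q) ▸ x.2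

theorem exists_isProjectiveCover_of_surjective [Module.Finite F P]
    (hσ : Module.Projective (MonoidAlgebra F H) σ.asModule) (f : σ.IntertwiningMap ρ)
    (hf : Function.Surjective f) :
    ∃ Q : Subrepresentation σ, IsProjectiveCover Q.toRepresentation ρ := by
  obtain ⟨Q, hQ⟩ := exists_isEssentialEpi_restrict f hf
  obtain ⟨k, hk⟩ := exists_lift hσ (f.comp (inclusionMap Q)) hQ.1 f
  have hk_surj : Function.Surjective (k.comp (inclusionMap Q)) := hQ.surjective_of_comp fun w ↦ by
    obtain ⟨q, rfl⟩ := hQ.1 w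
    exact ⟨q, hk q⟩
  have hk_bij : Function.Bijective (k.comp (inclusionMap Q)) :=
    ⟨LinearMap.injective_iff_surjective.mpr hk_surj, hk_surj⟩
  exact ⟨Q, projective_of_comp_bijective hσ hk_bij, _, hQ⟩

theorem exists_isProjectiveCover {F : Type u} {H : Type} [Field F] [Group H] [Finite H]
    [Module F M] (ρ : Representation F H M) [ρ.IsIrreducible] :
    ∃ (P : Type u) (_ : AddCommGroup P) (_ : Module F P) (σ : Representation F H P),
      IsProjectiveCover σ ρ := by
  obtain ⟨w, hw⟩ := exists_ne_zero_of_isIrreducible ρ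
  have hf : Function.Surjective ((leftRegularMapEquiv ρ).symm w) :=
    surjective_of_apply_ne_zero _ (v := .single 1 1) (by rwa [leftRegularMapEquiv_symm_one])
  have : Module.Finite F (MonoidAlgebra F H) := .of_basis (MonoidAlgebra.basis H F)
  have hreg : Module.Projective (MonoidAlgebra F H) (leftRegular F H).asModule :=
    .of_equiv ofMulActionSelfAsModuleEquiv.symm
  obtain ⟨Q, hQ⟩ := exists_isProjectiveCover_of_surjective hreg _ hf
  exact ⟨Q.toSubmodule, inferInstance, inferInstance, Q.toRepresentation, hQ⟩

section Restriction

variable {φ : K →* H} {ρ : Representation F K M} {τ : Representation F K N}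

theorem exists_equivariant_retraction (hφ : Function.Injective φ) :
    ∃ κ : H → K, ∀ k x, κ (φ k * x) = k * κ x := by
  obtain ⟨T, hT, -⟩ := φ.range.exists_isComplement_right 1
  refine ⟨fun x ↦ (MonoidHom.ofInjective hφ).symm (hT.equiv x).1, fun k x ↦ ?_⟩
  have hk := (MonoidHom.ofInjective hφ).symm_apply_apply k
  simp only [hT.equiv_mul_left_of_mem ⟨k, rfl⟩, map_mul]
  exact congrArg (· * _) hk

theorem coindMap_surjective (hφ : Function.Injective φ) (f : ρ.IntertwiningMap τ)
    (hf : Function.Surjective f) : Function.Surjective (coindMap φ f) := by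
  intro y
  obtain ⟨κ, hκ⟩ := exists_equivariant_retraction hφ
  choose s hs using hf
  refine ⟨⟨fun x ↦ ρ (κ x) (s (y.1 (φ (κ x)⁻¹ * x))), fun k x ↦ ?_⟩,
    Subtype.ext (funext fun x ↦ ?_)⟩
  · have hx : φ (k * κ x)⁻¹ * (φ k * x) = φ (κ x)⁻¹ * x := by simp [mul_assoc]
    simp only [hκ, hx, map_mul, Module.End.mul_apply]
  · rw [coindMap_coe_apply_apply]
    simp only
    rw [IntertwiningMap.isIntertwining, hs, ← y.2, ← mul_assoc, ← map_mul, mul_inv_cancel,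
      map_one, one_mul]

/-- The intertwining map into a coinduced representation adjoint to a map out of a restriction. -/
def toCoind (h : IntertwiningMap (σ.comp φ : Representation F K P) τ) :
    σ.IntertwiningMap (coind φ τ) where
  toFun v := ⟨fun x ↦ h (σ x v), fun k x ↦ by
    simp only [map_mul]
    exact h.isIntertwining _ _ k (σ x v)⟩
  map_add' a b := Subtype.ext <| by funext x; simp
  map_smul' a b := Subtype.ext <| by funext x; simp
  isIntertwining' y := by
    ext v x
    change h (σ x (σ y v)) = h (σ (x * y) v)
    rw [map_mul]
    rfl

/-- The counit of restriction and coinduction: evaluation at `1`. -/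
def coindEval (φ : K →* H) (ρ : Representation F K M) :
    IntertwiningMap ((coind φ ρ).comp φ : Representation F K _) ρ where
  toFun y := y.1 1
  map_add' _ _ := rfl
  map_smul' _ _ := rfl
  isIntertwining' k := by
    ext y
    change y.1 (1 * φ k) = ρ k (y.1 1)
    rw [one_mul, ← y.2 k 1, mul_one]

theorem exists_lift_comp (hφ : Function.Injective φ)
    (hσ : Module.Projective (MonoidAlgebra F H) σ.asModule)
    (f : ρ.IntertwiningMap τ) (hf : Function.Surjective f)
    (h : IntertwiningMap (σ.comp φ : Representation F K P) τ) :
    ∃ k : IntertwiningMap (σ.comp φ : Representation F K P) ρ, ∀ v, f (k v) = h v := by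
  obtain ⟨k, hk⟩ := exists_lift hσ (coindMap φ f) (coindMap_surjective hφ f hf) (toCoind h)
  let k' : IntertwiningMap (σ.comp φ : Representation F K P) ((coind φ ρ).comp φ) :=
    ⟨k.toLinearMap, fun x ↦ k.isIntertwining' (φ x)⟩
  refine ⟨(coindEval φ ρ).comp k', fun v ↦ ?_⟩
  calc f ((k v).1 1) = (toCoind h v).1 1 := by rw [← hk v, coindMap_coe_apply_apply]
    _ = h v := by change h (σ 1 v) = h v; rw [map_one]; rfl

theorem nonempty_equiv_of_surjective [Module.Finite F P] (hφ : Function.Injective φ)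
    (hσ : Module.Projective (MonoidAlgebra F H) σ.asModule) {π : ρ.IntertwiningMap τ}
    (hπ : IsEssentialEpi π) (h : IntertwiningMap (σ.comp φ : Representation F K P) τ)
    (hh : Function.Surjective h) (hrank : Module.finrank F P ≤ Module.finrank F M) :
    Nonempty (Representation.Equiv (σ.comp φ : Representation F K P) ρ) := by
  obtain ⟨k, hk⟩ := exists_lift_comp hφ hσ π hπ.1 h
  have hk_surj : Function.Surjective k := hπ.surjective_of_comp fun w ↦ by
    obtain ⟨v, rfl⟩ := hh w
    exact ⟨v, hk v⟩
  have : Module.Finite F M := .of_surjective k.toLinearMap hk_surj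
  have hrank' : Module.finrank F P = Module.finrank F M :=
    hrank.antisymm (LinearMap.finrank_le_finrank_of_surjective (f := k.toLinearMap) hk_surj)
  have hk_inj : Function.Injective k :=
    (LinearMap.injective_iff_surjective_of_finrank_eq_finrank hrank').mpr hk_surj
  exact ⟨IntertwiningMap.ofBijective k ⟨hk_inj, hk_surj⟩⟩

end Restriction

section Products

variable {M₁ M₂ N₁ N₂ : Type*} [AddCommGroup M₁] [Module F M₁] [AddCommGroup M₂] [Module F M₂]
  [AddCommGroup N₁] [Module F N₁] [AddCommGroup N₂] [Module F N₂]
  {ρ₁ : Representation F H M₁} {ρ₂ : Representation F H M₂}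
  {τ₁ : Representation F H N₁} {τ₂ : Representation F H N₂}

/-- The product of two intertwining maps, acting componentwise. -/
def prodMap (f₁ : ρ₁.IntertwiningMap τ₁) (f₂ : ρ₂.IntertwiningMap τ₂) :
    (ρ₁.prod ρ₂).IntertwiningMap (τ₁.prod τ₂) :=
  (f₁.comp (.fst F ρ₁ ρ₂)).prod (f₂.comp (.snd F ρ₁ ρ₂))

theorem IsEssentialEpi.prodMap {f₁ : ρ₁.IntertwiningMap τ₁} {f₂ : ρ₂.IntertwiningMap τ₂}
    (h₁ : IsEssentialEpi f₁) (h₂ : IsEssentialEpi f₂) : IsEssentialEpi (prodMap f₁ f₂) := by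
  have hsurj : Function.Surjective (SL2Rep.prodMap f₁ f₂) := Function.Surjective.prodMap h₁.1 h₂.1
  refine ⟨hsurj, fun X hX ↦ top_unique ?_⟩
  have hX' := (sup_ker_eq_top_iff hsurj X).mp hX
  let fst' := (IntertwiningMap.fst F ρ₁ ρ₂).comp (inclusionMap X)
  let snd' := (IntertwiningMap.snd F ρ₁ ρ₂).comp (inclusionMap X)
  have hsnd : Function.Surjective (snd'.comp (inclusionMap (f₁.comp fst').ker)) :=
    h₂.surjective_of_comp (f := snd'.comp (inclusionMap _)) fun w ↦ by
      obtain ⟨x, hx⟩ := hX' (0, w)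
      exact ⟨⟨x, congrArg Prod.fst hx⟩, congrArg Prod.snd hx⟩
  have hfst : Function.Surjective (fst'.comp (inclusionMap snd'.ker)) :=
    h₁.surjective_of_comp (f := fst'.comp (inclusionMap _)) fun w ↦ by
      obtain ⟨x, hx⟩ := hX' (w, 0)
      obtain ⟨y, hy⟩ := hsnd (snd' x)
      refine ⟨⟨x - y.1, ?_⟩, ?_⟩
      · exact (map_sub snd' x y.1).trans (sub_eq_zero.mpr hy.symm)
      · have hy' : f₁ (fst' y.1) = 0 := y.2
        exact (map_sub (f₁.comp fst') x y.1).trans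
          ((congrArg₂ (· - ·) (congrArg Prod.fst hx) hy').trans (sub_zero w))
  rintro ⟨v₁, v₂⟩ -
  obtain ⟨y, hy⟩ := hsnd v₂
  obtain ⟨x, hx⟩ := hfst (v₁ - fst' y.1)
  have hxy : x.1.1 + y.1.1 = (v₁, v₂) := by
    have hx₂ : x.1.1.2 = 0 := x.2
    have hx₁ : x.1.1.1 = v₁ - y.1.1.1 := hx
    have hy₂ : y.1.1.2 = v₂ := hy
    ext <;> simp [hx₁, hx₂, hy₂]
  exact hxy ▸ X.toSubmodule.add_mem x.1.2 y.1.2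

end Products

end ProjectiveCovers

section FixedPoints

variable {F P : Type*} [Field F] [AddCommGroup P] [Module F P] [Module.Finite F P]

theorem finrank_ker_comp_le (f f' : Module.End F P) :
    Module.finrank F (LinearMap.ker (f ∘ₗ f')) ≤
      Module.finrank F (LinearMap.ker f) + Module.finrank F (LinearMap.ker f') := by
  let r : LinearMap.ker (f ∘ₗ f') →ₗ[F] LinearMap.ker f := f'.restrict fun _ hx ↦ hx
  have hker : Module.finrank F (LinearMap.ker r) = Module.finrank F (LinearMap.ker f') := by
    have hr : LinearMap.ker r = (LinearMap.ker f').comap (LinearMap.ker (f ∘ₗ f')).subtype :=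
      (LinearMap.ker_restrict _).trans (LinearMap.ker_domRestrict _ _)
    rw [hr]
    exact (Submodule.comapSubtypeEquivOfLe (LinearMap.ker_le_ker_comp f' f)).finrank_eq
  rw [← LinearMap.finrank_range_add_finrank_ker r, hker]
  exact Nat.add_le_add_right (Submodule.finrank_le _) _

theorem finrank_ker_pow_le (f : Module.End F P) (n : ℕ) :
    Module.finrank F (LinearMap.ker (f ^ n)) ≤ n * Module.finrank F (LinearMap.ker f) := by
  induction n with
  | zero => simp [Module.End.one_eq_id]
  | succ n ih =>
    calc Module.finrank F (LinearMap.ker (f ^ (n + 1)))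
        ≤ Module.finrank F (LinearMap.ker (f ^ n)) + Module.finrank F (LinearMap.ker f) :=
          finrank_ker_comp_le (f ^ n) f
      _ ≤ (n + 1) * Module.finrank F (LinearMap.ker f) := by
          rw [add_mul, one_mul]
          exact Nat.add_le_add_right ih _

theorem finrank_le_mul_finrank_ker_sub_one {p : ℕ} [Fact p.Prime] [CharP F p] {f : Module.End F P}
    (hf : f ^ p = 1) :
    Module.finrank F P ≤ p * Module.finrank F (LinearMap.ker (f - 1)) := by
  rcases subsingleton_or_nontrivial P with hP | hP
  · exact Module.finrank_zero_of_subsingleton.trans_le (Nat.zero_le _)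
  have : CharP (Module.End F P) p :=
    charP_of_injective_algebraMap (algebraMap F (Module.End F P)).injective p
  have hnil : (f - 1) ^ p = 0 := by
    rw [sub_pow_char_of_commute _ (Commute.one_right f), hf, one_pow, sub_self]
  calc Module.finrank F P = Module.finrank F (LinearMap.ker ((f - 1) ^ p)) := by
        rw [hnil, LinearMap.ker_zero, finrank_top]
    _ ≤ p * Module.finrank F (LinearMap.ker (f - 1)) := finrank_ker_pow_le (f - 1) p

theorem finrank_le_mul_finrank_of_invariant_mem {p : ℕ} [Fact p.Prime] [CharP F p] {K : Type*}
    [Group K] (ρ : Representation F K P) {k : K} (hk : k ^ p = 1)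
    (S : Submodule F (Module.Dual F P))
    (hS : ∀ f : Module.Dual F P, (∀ v, f (ρ k v) = f v) → f ∈ S) :
    Module.finrank F P ≤ p * Module.finrank F S := by
  have hpow : ρ.dual k ^ p = 1 := by rw [← map_pow, hk, map_one]
  rw [← Subspace.dual_finrank_eq (K := F) (V := P)]
  refine (finrank_le_mul_finrank_ker_sub_one hpow).trans
    (Nat.mul_le_mul_left p (Submodule.finrank_mono fun f hf ↦ hS f fun v ↦ ?_))
  have hfix : f (ρ k⁻¹ (ρ k v)) = f (ρ k v) := LinearMap.congr_fun (sub_eq_zero.mp hf) (ρ k v)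
  rw [← hfix, inv_self_apply]

end FixedPoints

section BorelSubgroup

variable {p : ℕ}

/-- The isomorphism of the torus of `B` with `𝔽_pˣ`, inflated to `B`. -/
def torus (p : ℕ) : B p →* (ZMod p)ˣ where
  toFun b :=
    have h : b.1.1 0 0 * b.1.1 1 1 = 1 := by
      have hdet := b.1.2
      rwa [det_fin_two, (b.2 : b.1.1 1 0 = 0), mul_zero, sub_zero] at hdet
    ⟨b.1.1 0 0, b.1.1 1 1, h, (mul_comm _ _).trans h⟩
  map_one' := Units.ext rfl
  map_mul' b b' := Units.ext <| by
    have h : b'.1.1 1 0 = 0 := b'.2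
    simp [Matrix.mul_apply, Fin.sum_univ_two, h]

theorem torus_lam (c : (ZMod p)ˣ) : torus p (lam c) = c := Units.ext rfl

theorem torus_g : torus p (g p) = 1 := Units.ext rfl

theorem B_ext {b b' : B p} (htorus : torus p b = torus p b') (h : b.1.1 0 1 = b'.1.1 0 1) :
    b = b' := by
  apply Subtype.ext
  apply Subtype.ext
  ext i j
  fin_cases i <;> fin_cases j
  · exact congrArg Units.val htorus
  · exact h
  · exact (b.2 : b.1.1 1 0 = 0).trans (b'.2 : b'.1.1 1 0 = 0).symm
  · exact congrArg Units.inv htorus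

theorem B_mul_apply_zero_one (b b' : B p) :
    (b * b').1.1 0 1 = b.1.1 0 0 * b'.1.1 0 1 + b.1.1 0 1 * b'.1.1 1 1 := by
  change (b.1.1 * b'.1.1) 0 1 = _
  rw [Matrix.mul_apply, Fin.sum_univ_two]

theorem lam_mul (c c' : (ZMod p)ˣ) : lam (c * c') = lam c * lam c' := by
  refine B_ext (by rw [map_mul, torus_lam, torus_lam, torus_lam]) ?_
  rw [B_mul_apply_zero_one]
  simp [lam]

theorem lam_pow (c : (ZMod p)ˣ) (i : ℕ) : lam (c ^ i) = lam c ^ i :=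
  map_pow (MonoidHom.mk' lam lam_mul) c i

theorem g_pow_apply_zero_one (j : ℕ) : (g p ^ j).1.1 0 1 = j := by
  induction j with
  | zero => simp
  | succ j ih =>
    rw [pow_succ', B_mul_apply_zero_one, ih, Nat.cast_succ]
    have h : (g p ^ j).1.1 1 1 = 1 := congrArg Units.inv (by rw [map_pow, torus_g, one_pow] :
      torus p (g p ^ j) = 1)
    rw [h]
    simp [g]

theorem g_pow_p : g p ^ p = 1 := by
  refine B_ext (by rw [map_pow, torus_g, one_pow, map_one]) ?_
  rw [g_pow_apply_zero_one]
  simp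

theorem exists_eq_lam_mul_g_pow [NeZero p] (b : B p) :
    ∃ (c : (ZMod p)ˣ) (j : ℕ), b = lam c * g p ^ j := by
  refine ⟨torus p b, ((torus p b)⁻¹ * b.1.1 0 1 : ZMod p).val, B_ext ?_ ?_⟩
  · rw [map_mul, map_pow, torus_lam, torus_g, one_pow, mul_one]
  · rw [B_mul_apply_zero_one, g_pow_apply_zero_one]
    simp [lam]

end BorelSubgroup

section Characters

variable {F K M N : Type*} [Field F] [AddCommGroup M] [Module F M] [AddCommGroup N] [Module F N]

/-- The tensor product of a representation with a one-dimensional character. -/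
def twist [Group K] (χ : K →* Fˣ) (ρ : Representation F K M) : Representation F K M where
  toFun k := χ k • ρ k
  map_one' := by rw [map_one, map_one, one_smul]
  map_mul' k k' := by rw [map_mul, map_mul, smul_mul_smul_comm]

theorem isIntertwining_of_generators {p : ℕ} [NeZero p] {ζ : (ZMod p)ˣ}
    {ρ : Representation F (B p)ᵐᵒᵖ M} {τ : Representation F (B p)ᵐᵒᵖ N}
    (hζ : ∀ x : (ZMod p)ˣ, x ∈ Subgroup.zpowers ζ)
    (f : M →ₗ[F] N) (hg : f ∘ₗ ρ (op (g p)) = τ (op (g p)) ∘ₗ f)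
    (hlam : f ∘ₗ ρ (op (lam ζ)) = τ (op (lam ζ)) ∘ₗ f) (b : (B p)ᵐᵒᵖ) :
    f ∘ₗ ρ b = τ b ∘ₗ f := by
  have hmul {b b' : (B p)ᵐᵒᵖ} (hb : f ∘ₗ ρ b = τ b ∘ₗ f) (hb' : f ∘ₗ ρ b' = τ b' ∘ₗ f) :
      f ∘ₗ ρ (b * b') = τ (b * b') ∘ₗ f := by
    rw [map_mul, map_mul, Module.End.mul_eq_comp, ← LinearMap.comp_assoc, hb,
      LinearMap.comp_assoc, hb']
    rfl
  have hpow {b : (B p)ᵐᵒᵖ} (hb : f ∘ₗ ρ b = τ b ∘ₗ f) (n : ℕ) :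
      f ∘ₗ ρ (b ^ n) = τ (b ^ n) ∘ₗ f := by
    induction n with
    | zero => simp [Module.End.one_eq_id]
    | succ n ih => rw [pow_succ]; exact hmul ih hb
  obtain ⟨c, j, hb⟩ := exists_eq_lam_mul_g_pow b.unop
  obtain ⟨i, rfl : ζ ^ i = c⟩ := mem_powers_iff_mem_zpowers.mpr (hζ c)
  obtain rfl : b = op (g p) ^ j * op (lam ζ) ^ i := by
    rw [← op_unop b, hb, lam_pow, op_mul, op_pow, op_pow]
  exact hmul (hpow hg j) (hpow hlam i)

variable {p : ℕ} [CharP F p]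

/-- The character `(α β; 0 α⁻¹) ↦ α ^ a` of `B`, on the opposite group since modules are right
modules. -/
def borelChar (p : ℕ) (F : Type*) [Field F] [CharP F p] (a : ℤ) : (B p)ᵐᵒᵖ →* Fˣ :=
  ((Units.map (ZMod.castHom (dvd_refl p) F : ZMod p →* F)).comp (torus p)).fromOpposite
    (fun _ _ ↦ mul_comm _ _) ^ a

/-- The one-dimensional module on which `B` acts through `borelChar p F a`; it is `S_a`. -/
def charRep (p : ℕ) (F : Type*) [Field F] [CharP F p] (a : ℤ) : Representation F (B p)ᵐᵒᵖ F :=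
  twist (borelChar p F a) (trivial F (B p)ᵐᵒᵖ F)

theorem borelChar_apply (a : ℤ) (b : B p) :
    (borelChar p F a (op b) : F) = ZMod.castHom (dvd_refl p) F (torus p b) ^ a :=
  Units.val_zpow_eq_zpow_val _ _

theorem charRep_apply (a : ℤ) (b : B p) (x : F) :
    charRep p F a (op b) x = ZMod.castHom (dvd_refl p) F (torus p b) ^ a * x :=
  congrArg (· * x) (borelChar_apply a b)

variable [Fact p.Prime] {ζ : (ZMod p)ˣ} {ρ : Representation F (B p)ᵐᵒᵖ M}

theorem borelChar_add_mul_sub_one (a m : ℤ) :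
    borelChar p F (a + m * (p - 1 : ℕ)) = borelChar p F a := by
  have h (b : B p) : ZMod.castHom (dvd_refl p) F (torus p b) ^ ((p - 1 : ℕ) : ℤ) = 1 := by
    rw [zpow_natCast, ← map_pow, ZMod.pow_card_sub_one_eq_one (torus p b).ne_zero, map_one]
  ext b
  rw [← op_unop b, borelChar_apply, borelChar_apply, zpow_add₀ ((torus p _).isUnit.map _).ne_zero,
    mul_comm m, _root_.zpow_mul, h, _root_.one_zpow, mul_one]

theorem IsS.nonempty_equiv (hζ : ∀ x : (ZMod p)ˣ, x ∈ Subgroup.zpowers ζ) {a : ℤ}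
    (hρ : IsS ζ a ρ) : Nonempty (ρ.Equiv (charRep p F a)) := by
  obtain ⟨hrank, hg, hlam⟩ := hρ
  have := Module.finite_of_finrank_pos (hrank.trans_gt one_pos)
  let e := LinearEquiv.ofFinrankEq M F (hrank.trans (Module.finrank_self F).symm)
  let f : ρ.IntertwiningMap (charRep p F a) :=
    { toLinearMap := e.toLinearMap
      isIntertwining' := isIntertwining_of_generators hζ _
        (LinearMap.ext fun v ↦ by simp [hg, charRep_apply, torus_g])
        (LinearMap.ext fun v ↦ by simp [hlam, charRep_apply, torus_lam]) }
  exact ⟨IntertwiningMap.ofBijective f e.bijective⟩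

theorem IsU.exists_isEssentialEpi_charRep (hζ : ∀ x : (ZMod p)ˣ, x ∈ Subgroup.zpowers ζ) {a : ℤ}
    (hρ : IsU ζ a p ρ) : ∃ f : ρ.IntertwiningMap (charRep p F a), IsEssentialEpi f := by
  obtain ⟨huni, -, W, -, htop, hW⟩ := hρ
  have hp := (Fact.out : p.Prime).one_le
  let i : Fin p := ⟨p - 1, Nat.sub_one_lt_of_le hp le_rfl⟩
  have hi : W i.succ = ⊤ := htop ▸ congrArg W (Fin.ext (Nat.sub_add_cancel hp))
  obtain ⟨e⟩ := (hW i).2.nonempty_equiv hζ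
  have hchar : charRep p F (a + 2 * (i : ℕ)) = charRep p F a :=
    congrArg (twist · _) (borelChar_add_mul_sub_one a 2)
  rw [hchar] at e
  refine ⟨e.toIntertwiningMap.comp (subquotientMk (W i.castSucc) hi),
    huni.isEssentialEpi fun x ↦ ?_⟩
  obtain ⟨v, hv⟩ := Submodule.Quotient.mk_surjective _ (e.symm x)
  exact ⟨v, (congrArg e hv).trans (e.apply_symm_apply x)⟩

end Characters

section BinaryForms

open Polynomial

theorem aeval_smul_of_isHomogeneous {ι R A : Type*} [CommSemiring R] [CommSemiring A] [Algebra R A]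
    {f : MvPolynomial ι R} {n : ℕ} (hf : f.IsHomogeneous n) (c : A) (v : ι → A) :
    MvPolynomial.aeval (c • v) f = c ^ n * MvPolynomial.aeval v f := by
  rw [f.as_sum, map_sum, map_sum, Finset.mul_sum]
  refine Finset.sum_congr rfl fun s hs ↦ ?_
  have hdeg : s.degree = n := (DFunLike.congr_fun Finsupp.degree_eq_weight_one s).trans
    (hf (MvPolynomial.mem_support_iff.mp hs))
  simp only [MvPolynomial.aeval_monomial, Pi.smul_apply, smul_eq_mul, mul_pow, ← hdeg,
    Finsupp.degree_apply, Finsupp.prod, Finset.prod_mul_distrib, ← Finset.prod_pow_eq_pow_sum]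
  exact mul_left_comm _ _ _

variable {F : Type*} [Field F]

theorem coeff_taylor_of_natDegree_le {f : F[X]} {n : ℕ} (hf : f.natDegree ≤ n) (c : F) :
    (taylor c f).coeff n = f.coeff n := by
  rcases hf.eq_or_lt with rfl | hlt
  · exact coeff_taylor_natDegree c f
  · rw [coeff_eq_zero_of_natDegree_lt hlt,
      coeff_eq_zero_of_natDegree_lt ((natDegree_taylor f c).trans_lt hlt)]

theorem comp_linear_eq_taylor_comp (f : F[X]) (a c : F) :
    f.comp (C a * X + C c) = (taylor c f).comp (C a * X) := by
  rw [taylor_apply, comp_assoc, add_comp, X_comp, C_comp]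

theorem coeff_taylor_one_sub_self {f : F[X]} {n : ℕ} (hf : f.natDegree ≤ n + 1) :
    (taylor 1 f - f).coeff n = (n + 1) * f.coeff (n + 1) := by
  have hderiv : (hasseDeriv n f).natDegree < 2 :=
    (natDegree_hasseDeriv_le f n).trans_lt (by omega)
  rw [coeff_sub, taylor_coeff, eval_eq_sum_range' hderiv]
  simp [Finset.sum_range_succ, hasseDeriv_coeff, add_comm 1 n]

theorem degree_taylor_one_sub_self {f : F[X]} {n : ℕ} (hf : f.degree = (n + 1 : ℕ))
    (hn : ((n + 1 : ℕ) : F) ≠ 0) : (taylor 1 f - f).degree = n := by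
  have hf0 : f ≠ 0 := ne_zero_of_coe_le_degree hf.ge
  have hlt : (taylor 1 f - f).degree < (n + 1 : ℕ) := by
    rw [← hf, ← degree_taylor f 1]
    exact degree_sub_lt_left (degree_taylor f 1) ((taylor_eq_zero 1 f).not.mpr hf0)
      (leadingCoeff_taylor 1 f)
  refine degree_eq_of_le_of_coeff_ne_zero ?_ ?_
  · rwa [← mem_degreeLE, ← degreeLT_succ_eq_degreeLE, mem_degreeLT]
  · rw [coeff_taylor_one_sub_self (natDegree_eq_of_degree_eq_some hf).le]
    exact mul_ne_zero (mod_cast hn) (coeff_ne_zero_of_eq_degree hf)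

theorem degreeLT_succ_le_of_degreeLT_le {S : Submodule F F[X]} {f : F[X]} {n : ℕ} (hf : f ∈ S)
    (hdeg : f.degree = n) (hn : degreeLT F n ≤ S) : degreeLT F (n + 1) ≤ S := by
  intro h hh
  have hc : f.coeff n ≠ 0 := coeff_ne_zero_of_eq_degree hdeg
  suffices h - (h.coeff n / f.coeff n) • f ∈ degreeLT F n by
    simpa using S.add_mem (hn this) (S.smul_mem (h.coeff n / f.coeff n) hf)
  rw [mem_degreeLT] at hh ⊢
  refine (degree_lt_iff_coeff_zero _ _).mpr fun m hm ↦ ?_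
  rw [coeff_sub, coeff_smul, smul_eq_mul]
  rcases hm.eq_or_lt with rfl | hlt
  · rw [div_mul_cancel₀ _ hc, sub_self]
  · rw [coeff_eq_zero_of_degree_lt (hh.trans_le (Nat.cast_le.mpr hlt)),
      coeff_eq_zero_of_degree_lt (p := f) (hdeg.trans_lt (Nat.cast_lt.mpr hlt)), mul_zero, sub_zero]

variable {p : ℕ} [CharP F p]

theorem degreeLT_succ_le_of_taylor_mem {S : Submodule F F[X]} (hS : ∀ f ∈ S, taylor 1 f ∈ S)
    {f : F[X]} {n : ℕ} (hf : f ∈ S) (hdeg : f.degree = n) (hn : n < p) :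
    degreeLT F (n + 1) ≤ S := by
  induction n generalizing f with
  | zero =>
    refine degreeLT_succ_le_of_degreeLT_le hf hdeg fun h hh ↦ ?_
    rw [degree_eq_bot.mp (Nat.WithBot.lt_zero_iff.mp (mem_degreeLT.mp hh))]
    exact S.zero_mem
  | succ n ih =>
    have hchar : ((n + 1 : ℕ) : F) ≠ 0 := fun h ↦
      (Nat.le_of_dvd n.succ_pos ((CharP.cast_eq_zero_iff F p _).mp h)).not_gt hn
    exact degreeLT_succ_le_of_degreeLT_le hf hdeg <|
      ih (S.sub_mem (hS f hf) hf) (degree_taylor_one_sub_self hdeg hchar) (n.lt_succ_self.trans hn)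

theorem mem_of_taylor_mem {S : Submodule F F[X]} (hS : ∀ f ∈ S, taylor 1 f ∈ S) {f h : F[X]}
    (hf : f ∈ S) (hfp : f.degree < p) (hh : h.degree ≤ f.degree) : h ∈ S := by
  by_cases hf0 : f = 0
  · rw [hf0, degree_zero, le_bot_iff, degree_eq_bot] at hh
    exact hh ▸ S.zero_mem
  · rw [degree_eq_natDegree hf0, Nat.cast_lt] at hfp
    refine degreeLT_succ_le_of_taylor_mem hS hf (degree_eq_natDegree hf0) hfp ?_
    rw [mem_degreeLT]
    exact (hh.trans degree_le_natDegree).trans_lt (mod_cast f.natDegree.lt_succ_self)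

/-- Dehomogenization `x ↦ X, y ↦ 1`, under which `g` acts on the image of `V_t` by `X ↦ X + 1`. -/
def dehom (p : ℕ) (F : Type*) [Field F] [CharP F p] (t : ℕ) :
    (VSub p F t).toSubmodule →ₗ[F] F[X] :=
  (MvPolynomial.aeval ![X, 1]).toLinearMap ∘ₗ (VSub p F t).toSubmodule.subtype

theorem dehom_apply {t : ℕ} (f : (VSub p F t).toSubmodule) :
    dehom p F t f = MvPolynomial.aeval ![X, 1] f.1 := rfl

theorem dehom_injective (t : ℕ) : Function.Injective (dehom p F t) := fun f f' h ↦
  Subtype.ext <| (homogenize_eq_of_isHomogeneous f.2 h).symm.trans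
    (homogenize_eq_of_isHomogeneous f'.2 rfl)

theorem dehom_mem_degreeLT {t : ℕ} (ht : 1 ≤ t) (f : (VSub p F t).toSubmodule) :
    dehom p F t f ∈ degreeLT F t := by
  obtain ⟨n, rfl⟩ := Nat.exists_eq_add_of_le' ht
  have hf : f.1.IsHomogeneous n := f.2
  rw [degreeLT_succ_eq_degreeLE, mem_degreeLE, ← natDegree_le_iff_degree_le]
  refine (MvPolynomial.aeval_natDegree_le _ hf.totalDegree_le _ fun i ↦ ?_).trans_eq (mul_one n)
  fin_cases i <;> simp

/-- Homogenization of a polynomial to a form of degree `t - 1`. -/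
def homog (p : ℕ) {F : Type*} [Field F] [CharP F p] (t : ℕ) (h : F[X]) :
    (VSub p F t).toSubmodule :=
  ⟨h.homogenize (t - 1), isHomogeneous_homogenize h⟩

theorem dehom_homog {t : ℕ} (ht : 1 ≤ t) {h : F[X]} (hh : h ∈ degreeLT F t) :
    dehom p F t (homog p t h) = h := by
  obtain ⟨n, rfl⟩ := Nat.exists_eq_add_of_le' ht
  rw [degreeLT_succ_eq_degreeLE, mem_degreeLE, ← natDegree_le_iff_degree_le] at hh
  exact aeval_homogenize_X_one h hh

theorem range_dehom {t : ℕ} (ht : 1 ≤ t) : LinearMap.range (dehom p F t) = degreeLT F t :=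
  le_antisymm (by rintro _ ⟨f, rfl⟩; exact dehom_mem_degreeLT ht f)
    fun h hh ↦ ⟨homog p t h, dehom_homog ht hh⟩

theorem finrank_VSub {t : ℕ} (ht : 1 ≤ t) : Module.finrank F (VSub p F t).toSubmodule = t := by
  rw [← LinearMap.finrank_range_of_inj (dehom_injective t), range_dehom ht,
    (degreeLTEquiv F t).finrank_eq, Module.finrank_fin_fun]

theorem finite_VSub {t : ℕ} (ht : 1 ≤ t) : Module.Finite F (VSub p F t).toSubmodule :=
  Module.finite_of_finrank_pos (ht.trans_eq (finrank_VSub ht).symm)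

theorem dehom_comp {t : ℕ} (f : (VSub p F t).toSubmodule) (q : F[X]) :
    (dehom p F t f).comp q = MvPolynomial.aeval ![q, 1] f.1 := by
  rw [comp_eq_aeval, dehom_apply, ← AlgHom.comp_apply, MvPolynomial.comp_aeval]
  congr 2
  ext1 i
  fin_cases i <;> simp

theorem dehom_V_apply {t : ℕ} (b : B p) (f : (VSub p F t).toSubmodule) :
    dehom p F t (V p F t (op b.1) f) =
      C (ZMod.castHom (dvd_refl p) F (b.1.1 1 1) ^ (t - 1)) * (dehom p F t f).comp
        (C (ZMod.castHom (dvd_refl p) F (b.1.1 0 0 ^ 2)) * X +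
          C (ZMod.castHom (dvd_refl p) F (b.1.1 0 0 * b.1.1 0 1))) := by
  have hb : b.1.1 1 0 = 0 := b.2
  have hdet : C (ZMod.castHom (dvd_refl p) F (b.1.1 1 1)) *
      C (ZMod.castHom (dvd_refl p) F (b.1.1 0 0)) = 1 := by
    rw [← C_mul, ← map_mul, ← C_1, ← map_one (ZMod.castHom (dvd_refl p) F)]
    exact congrArg _ (congrArg _ (torus p b).inv_val)
  change MvPolynomial.aeval _ (subst F b.1 f.1) = _
  rw [dehom_comp, C_pow, ← aeval_smul_of_isHomogeneous f.2, subst, ← AlgHom.comp_apply,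
    MvPolynomial.comp_aeval]
  congr 2
  ext1 i
  fin_cases i
  · simp only [Fin.sum_univ_two, map_add, map_mul, map_pow, MvPolynomial.aeval_X,
      MvPolynomial.aeval_C, Polynomial.algebraMap_eq, Pi.smul_apply, smul_eq_mul, Fin.zero_eta,
      Fin.isValue, cons_val_zero, cons_val_one, mul_one]
    linear_combination (-C (ZMod.castHom (dvd_refl p) F (b.1.1 0 0)) * X -
      C (ZMod.castHom (dvd_refl p) F (b.1.1 0 1))) * hdet
  · simp [Fin.sum_univ_two, hb, Polynomial.algebraMap_eq]

theorem dehom_V_g {t : ℕ} (f : (VSub p F t).toSubmodule) :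
    dehom p F t (V p F t (op (g p).1) f) = taylor 1 (dehom p F t f) := by
  rw [dehom_V_apply, taylor_apply]
  simp [g]

theorem mem_of_V_g_mem {t : ℕ} (ht : 1 ≤ t) (htp : t ≤ p)
    {S : Submodule F (VSub p F t).toSubmodule} (hS : ∀ f ∈ S, V p F t (op (g p).1) f ∈ S)
    {f h : (VSub p F t).toSubmodule} (hf : f ∈ S)
    (hh : (dehom p F t h).degree ≤ (dehom p F t f).degree) : h ∈ S := by
  have hmap : ∀ q ∈ S.map (dehom p F t), taylor 1 q ∈ S.map (dehom p F t) := by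
    rintro _ ⟨f, hf, rfl⟩
    exact ⟨_, hS f hf, dehom_V_g f⟩
  have hfp := (mem_degreeLT.mp (dehom_mem_degreeLT ht f)).trans_le (Nat.cast_le.mpr htp)
  obtain ⟨h', hh', heq⟩ := mem_of_taylor_mem hmap (Submodule.mem_map_of_mem hf) hfp hh
  exact dehom_injective t heq ▸ hh'

/-- The Weyl element `(0 1; -1 0)`. -/
def weyl (p : ℕ) : G p := ⟨!![0, 1; -1, 0], by simp [Matrix.det_fin_two]⟩

theorem isIrreducible_V {t : ℕ} (ht : 1 ≤ t) (htp : t ≤ p) : (V p F t).IsIrreducible := by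
  have key (N : Subrepresentation (V p F t)) {f h : (VSub p F t).toSubmodule} (hf : f ∈ N)
      (hh : (dehom p F t h).degree ≤ (dehom p F t f).degree) : h ∈ N :=
    mem_of_V_g_mem ht htp (fun _ hf ↦ N.apply_mem_toSubmodule _ hf) hf hh
  let yn : (VSub p F t).toSubmodule := ⟨.X 1 ^ (t - 1), MvPolynomial.isHomogeneous_X_pow _ _⟩
  have hyn : dehom p F t yn = 1 := by simp [yn, dehom_apply]
  have hxn : dehom p F t (V p F t (op (weyl p)) yn) = (-X) ^ (t - 1) := by
    change MvPolynomial.aeval _ (subst F (weyl p) (.X 1 ^ (t - 1))) = _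
    rw [map_pow, subst_X]
    simp [weyl, Fin.sum_univ_two]
  have hntriv : Nontrivial (Subrepresentation (V p F t)) := by
    refine ⟨⊥, ⊤, fun h ↦ ?_⟩
    have h0 : yn = 0 := (h ▸ trivial : yn ∈ (⊥ : Subrepresentation (V p F t)))
    exact one_ne_zero (hyn.symm.trans (h0 ▸ map_zero _))
  refine ⟨fun N ↦ or_iff_not_imp_left.mpr fun hN ↦ top_unique fun h _ ↦ ?_⟩
  obtain ⟨f, hf, hf0⟩ : ∃ f ∈ N, f ≠ 0 := by
    by_contra! h0
    exact hN (le_bot_iff.mp fun f hf ↦ h0 f hf)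
  have hyN : yn ∈ N := key N hf <| by
    rw [hyn, degree_one]
    exact zero_le_degree_iff.mpr ((map_ne_zero_iff _ (dehom_injective t)).mpr hf0)
  refine key N (N.apply_mem_toSubmodule (op (weyl p)) hyN) ?_
  have hdeg : ((-X : F[X]) ^ (t - 1)).degree = (t - 1 : ℕ) := by simp
  rw [hxn, hdeg, ← mem_degreeLE, ← degreeLT_succ_eq_degreeLE, Nat.sub_add_cancel ht]
  exact dehom_mem_degreeLT ht h

/-- A model of `U_{a,b}`: the restriction of `V_b`, twisted so that its socle is `S_a`. -/
def uniserialRep (p : ℕ) (F : Type*) [Field F] [CharP F p] (a : ℤ) (b : ℕ) :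
    Representation F (B p)ᵐᵒᵖ (VSub p F b).toSubmodule :=
  twist (borelChar p F (a + (b - 1 : ℕ))) (res (V p F b))

theorem coeff_dehom_uniserialRep {a : ℤ} {t i : ℕ} (b : B p) {f : (VSub p F t).toSubmodule}
    (hf : (dehom p F t f).natDegree ≤ i) :
    (dehom p F t (uniserialRep p F a t (op b) f)).coeff i =
      ZMod.castHom (dvd_refl p) F (torus p b) ^ (a + 2 * i) * (dehom p F t f).coeff i := by
  have hα : ZMod.castHom (dvd_refl p) F (torus p b) ≠ 0 := fun h0 ↦ by
    have h := (borelChar p F 1 (op b)).ne_zero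
    rw [borelChar_apply, zpow_one] at h
    exact h h0
  have hdet : ZMod.castHom (dvd_refl p) F (torus p b) * ZMod.castHom (dvd_refl p) F (b.1.1 1 1) =
      1 := by
    rw [← map_mul, ← map_one (ZMod.castHom (dvd_refl p) F)]
    exact congrArg _ (torus p b).mul_inv
  have hcoeff : (dehom p F t (V p F t (op b.1) f)).coeff i =
      (ZMod.castHom (dvd_refl p) F (torus p b) ^ (t - 1))⁻¹ *
        ((dehom p F t f).coeff i * ZMod.castHom (dvd_refl p) F (torus p b) ^ (2 * i)) := by
    rw [dehom_V_apply, coeff_C_mul, comp_linear_eq_taylor_comp, comp_C_mul_X_coeff,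
      coeff_taylor_of_natDegree_le hf, map_pow, ← pow_mul, eq_inv_of_mul_eq_one_right hdet, inv_pow]
    rfl
  change (dehom p F t ((borelChar p F _ (op b) : F) • V p F t (op b.1) f)).coeff i = _
  rw [map_smul, coeff_smul, hcoeff, borelChar_apply, smul_eq_mul, zpow_add₀ hα, zpow_add₀ hα,
    zpow_natCast]
  have h2 : (2 * i : ℤ) = (2 * i : ℕ) := by norm_cast
  rw [h2, zpow_natCast]
  field_simp

/-- The forms whose degree in `x` is less than `i`. -/
def degreeFiltration (p : ℕ) (F : Type*) [Field F] [CharP F p] (a : ℤ) (t i : ℕ) :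
    Subrepresentation (uniserialRep p F a t) where
  toSubmodule := (degreeLT F i).comap (dehom p F t)
  apply_mem_toSubmodule b f hf := by
    rw [Submodule.mem_comap, mem_degreeLT] at hf ⊢
    refine (degree_lt_iff_coeff_zero _ _).mpr fun m hm ↦ ?_
    have hfm := hf.trans_le (Nat.cast_le.mpr hm)
    rw [← op_unop b, coeff_dehom_uniserialRep _ (natDegree_le_of_degree_le hfm.le),
      coeff_eq_zero_of_degree_lt hfm, mul_zero]

theorem uniserialRep_g (a : ℤ) {t : ℕ} (f : (VSub p F t).toSubmodule) :
    uniserialRep p F a t (op (g p)) f = V p F t (op (g p).1) f := by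
  have hχ : borelChar p F (a + (t - 1 : ℕ)) (op (g p)) = 1 := Units.ext <| by
    rw [borelChar_apply, torus_g, Units.val_one, map_one, _root_.one_zpow, Units.val_one]
  change borelChar p F (a + (t - 1 : ℕ)) (op (g p)) • V p F t (op (g p).1) f = _
  rw [hχ, one_smul]

theorem isUniserial_uniserialRep (a : ℤ) {t : ℕ} (ht : 1 ≤ t) (htp : t ≤ p) :
    IsUniserial (uniserialRep p F a t) := by
  intro N₁ N₂
  refine or_iff_not_imp_left.mpr fun hle h hh ↦ ?_
  obtain ⟨f, hf, hfN⟩ := SetLike.not_le_iff_exists.mp hle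
  have hg (N : Subrepresentation (uniserialRep p F a t)) (f) (hf : f ∈ N.toSubmodule) :
      V p F t (op (g p).1) f ∈ N.toSubmodule :=
    uniserialRep_g a f ▸ N.apply_mem_toSubmodule (op (g p)) hf
  by_cases hdeg : (dehom p F t h).degree ≤ (dehom p F t f).degree
  · exact mem_of_V_g_mem ht htp (hg N₁) hf hdeg
  · exact absurd (mem_of_V_g_mem ht htp (hg N₂) hh (not_le.mp hdeg).le) hfN

theorem isS_subquotient {M : Type*} [AddCommGroup M] [Module F M]
    {ρ : Representation F (B p)ᵐᵒᵖ M} {N₁ N₂ : Subrepresentation ρ} (c : Module.Dual F M)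
    (hker : ∀ v ∈ N₂, v ∈ N₁ ↔ c v = 0) (hc : ∃ v ∈ N₂, c v ≠ 0) (ζ : (ZMod p)ˣ) {a : ℤ}
    (hact : ∀ b : B p, ∀ v ∈ N₂,
      c (ρ (op b) v) = ZMod.castHom (dvd_refl p) F (torus p b) ^ a * c v) :
    IsS ζ a (subquotient N₁ N₂) := by
  have hN : N₁.toSubmodule.comap N₂.toSubmodule.subtype =
      LinearMap.ker (c ∘ₗ N₂.toSubmodule.subtype) := Submodule.ext fun v ↦ hker v v.2
  have hmk (b : B p) (v) : subquotient N₁ N₂ (op b) v =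
      ZMod.castHom (dvd_refl p) F (torus p b) ^ a • v := by
    obtain ⟨v, rfl⟩ := Submodule.Quotient.mk_surjective _ v
    refine (Submodule.Quotient.eq _).mpr ?_
    rw [hN, LinearMap.mem_ker, map_sub, map_smul]
    exact sub_eq_zero.mpr (hact b v v.2)
  refine ⟨?_, fun v ↦ ?_, fun v ↦ ?_⟩
  · obtain ⟨v, hv, hcv⟩ := hc
    have hne : c ∘ₗ N₂.toSubmodule.subtype ≠ 0 := fun h ↦ hcv (LinearMap.congr_fun h ⟨v, hv⟩)
    rw [hN, (LinearMap.quotKerEquivOfSurjective _ (LinearMap.surjective hne)).finrank_eq,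
      Module.finrank_self]
  · rw [hmk, torus_g, Units.val_one, map_one, _root_.one_zpow, one_smul]
  · rw [hmk, torus_lam]

theorem isU_uniserialRep (ζ : (ZMod p)ˣ) (a : ℤ) {t : ℕ} (ht : 1 ≤ t) (htp : t ≤ p) :
    IsU ζ a t (uniserialRep p F a t) := by
  refine ⟨isUniserial_uniserialRep a ht htp, finrank_VSub ht,
    fun i ↦ degreeFiltration p F a t i, ?_, ?_, fun i ↦ ⟨?_, ?_⟩⟩
  · refine le_bot_iff.mp fun f hf ↦ dehom_injective t ?_
    rw [map_zero, ← degree_eq_bot, ← Nat.WithBot.lt_zero_iff]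
    exact mem_degreeLT.mp hf
  · exact top_unique fun f _ ↦ dehom_mem_degreeLT ht f
  · exact Submodule.comap_mono (degreeLT_mono i.val.le_succ)
  have hcoeff {m : ℕ} {f : (VSub p F t).toSubmodule} (hf : f ∈ degreeFiltration p F a t m) {k : ℕ}
      (hk : m ≤ k) : (dehom p F t f).coeff k = 0 :=
    (degree_lt_iff_coeff_zero _ _).mp (mem_degreeLT.mp hf) k hk
  have hX : X ^ i.val ∈ degreeLT F t := by
    rw [mem_degreeLT, degree_X_pow]
    exact Nat.cast_lt.mpr i.2
  refine isS_subquotient (lcoeff F i ∘ₗ dehom p F t) (fun f hf ↦ ⟨fun h ↦ hcoeff h le_rfl,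
    fun h ↦ mem_degreeLT.mpr ((degree_lt_iff_coeff_zero _ _).mpr fun k hk ↦ ?_)⟩)
    ⟨homog p t (X ^ i.val), ?_, ?_⟩ ζ fun b f hf ↦ coeff_dehom_uniserialRep b
      (natDegree_le_iff_coeff_eq_zero.mpr fun k hk ↦ hcoeff hf hk)
  · rcases hk.eq_or_lt with rfl | hlt
    · exact h
    · exact hcoeff hf hlt
  · refine mem_degreeLT.mpr ?_
    rw [dehom_homog ht hX, degree_X_pow]
    exact Nat.cast_lt.mpr i.val.lt_succ_self
  · rw [LinearMap.comp_apply, dehom_homog ht hX, lcoeff_apply, coeff_X_pow_self]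
    exact one_ne_zero

end BinaryForms

section FunctionsOnPlane

theorem sum_eval_ringHom_comp_eq_zero {K A ι : Type*} [Field K] [Fintype K] [CommRing A]
    [Fintype ι] [DecidableEq ι] (φ : K →+* A) {f : MvPolynomial ι A}
    (hf : f.totalDegree < (Fintype.card K - 1) * Fintype.card ι) :
    ∑ x : ι → K, MvPolynomial.eval (φ ∘ x) f = 0 := by
  have hmonomial : ∀ d ∈ f.support, ∑ x : ι → K, ∏ i, x i ^ d i = 0 := fun d hd ↦ by
    have hd : (MvPolynomial.monomial d (1 : K)).totalDegree ≤ f.totalDegree :=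
      (MvPolynomial.totalDegree_monomial_le _ _).trans (MvPolynomial.le_totalDegree hd)
    simpa only [MvPolynomial.eval_monomial, one_mul, Finsupp.prod_pow] using
      MvPolynomial.sum_eval_eq_zero _ (hd.trans_lt hf)
  simp only [MvPolynomial.eval_eq', Function.comp_apply, ← map_pow, ← map_prod]
  rw [Finset.sum_comm]
  refine Finset.sum_eq_zero fun d hd ↦ ?_
  rw [← Finset.mul_sum, ← map_sum, hmonomial d hd, map_zero, mul_zero]

theorem exists_apply_eq_of_finrank_le {F V W U : Type*} [Field F] [AddCommGroup V] [Module F V]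
    [AddCommGroup W] [Module F W] [AddCommGroup U] [Module F U] [Module.Finite F W]
    {e : V →ₗ[F] W} {q : W →ₗ[F] U} (he : Function.Injective e) (hq : Function.Surjective q)
    (hqe : ∀ v, q (e v) = 0)
    (hle : Module.finrank F W ≤ Module.finrank F V + Module.finrank F U) {w : W} (hw : q w = 0) :
    ∃ v, e v = w := by
  have hrank := LinearMap.finrank_range_add_finrank_ker q
  rw [LinearMap.range_eq_top.mpr hq, finrank_top] at hrank
  have hexact : LinearMap.range e = LinearMap.ker q := by
    refine Submodule.eq_of_le_of_finrank_le (by rintro _ ⟨v, rfl⟩; exact hqe v) ?_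
    rw [LinearMap.finrank_range_of_inj he]
    omega
  exact hexact.ge hw

variable {p : ℕ} {F : Type*} [Field F]

/-- The right action of `G` on functions on `𝔽_p²`, `(f · A) (w) = f (A w)`. -/
def funRep (p : ℕ) (F : Type*) [Field F] :
    Representation F (G p)ᵐᵒᵖ ((Fin 2 → ZMod p) → F) where
  toFun A := LinearMap.funLeft F F fun w ↦ A.unop.1 *ᵥ w
  map_one' := LinearMap.ext fun f ↦ funext fun w ↦ congrArg f (one_mulVec w)
  map_mul' _ _ := LinearMap.ext fun f ↦ funext fun w ↦ congrArg f (mulVec_mulVec w _ _).symm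

theorem funRep_apply (A : (G p)ᵐᵒᵖ) (f : (Fin 2 → ZMod p) → F) (w : Fin 2 → ZMod p) :
    funRep p F A f w = f (A.unop.1 *ᵥ w) := rfl

theorem mulVec_eq_zero_iff (A : G p) {w : Fin 2 → ZMod p} : A.1 *ᵥ w = 0 ↔ w = 0 :=
  (Matrix.SpecialLinearGroup.toLin' A).map_eq_zero_iff

variable [CharP F p]

/-- Evaluation of a polynomial at a vector of `𝔽_p²`. -/
def evalAt (F : Type*) [Field F] [CharP F p] (w : Fin 2 → ZMod p) :
    MvPolynomial (Fin 2) F →ₐ[F] F :=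
  MvPolynomial.aeval (ZMod.castHom (dvd_refl p) F ∘ w)

theorem evalAt_subst (A : G p) (w : Fin 2 → ZMod p) (f : MvPolynomial (Fin 2) F) :
    evalAt F w (subst F A f) = evalAt F (A.1 *ᵥ w) f := by
  rw [evalAt, evalAt, subst, ← AlgHom.comp_apply, MvPolynomial.comp_aeval]
  congr 2
  ext1 i
  simp only [map_sum, map_mul, MvPolynomial.aeval_X, MvPolynomial.algHom_C, Function.comp_apply,
    mulVec, dotProduct, Algebra.algebraMap_self, RingHom.id_apply]

theorem evalAt_smul {n : ℕ} {f : MvPolynomial (Fin 2) F} (hf : f.IsHomogeneous n)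
    (c : ZMod p) (w : Fin 2 → ZMod p) :
    evalAt F (c • w) f = ZMod.castHom (dvd_refl p) F c ^ n * evalAt F w f := by
  have hcomp : ZMod.castHom (dvd_refl p) F ∘ (c • w) =
      ZMod.castHom (dvd_refl p) F c • ZMod.castHom (dvd_refl p) F ∘ w :=
    funext fun i ↦ map_mul _ _ _
  rw [evalAt, hcomp, aeval_smul_of_isHomogeneous hf, evalAt]

/-- The function defined by a form, set to `0` at the origin (this changes it only for `t = 1`). -/
def formToFun (p : ℕ) (F : Type*) [Field F] [CharP F p] (t : ℕ) :
    (V p F t).IntertwiningMap (funRep p F) where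
  toFun f w := if w = 0 then 0 else evalAt F w f.1
  map_add' f h := by ext w; by_cases hw : w = 0 <;> simp [hw]
  map_smul' c f := by ext w; by_cases hw : w = 0 <;> simp [hw]
  isIntertwining' A := by
    refine LinearMap.ext fun f ↦ funext fun w ↦ ?_
    change (if w = 0 then 0 else evalAt F w (subst F A.unop f.1)) =
      if A.unop.1 *ᵥ w = 0 then 0 else evalAt F (A.unop.1 *ᵥ w) f.1
    simp only [evalAt_subst, mulVec_eq_zero_iff]

theorem formToFun_apply {t : ℕ} (f : (VSub p F t).toSubmodule) (w : Fin 2 → ZMod p) :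
    formToFun p F t f w = if w = 0 then 0 else evalAt F w f.1 := rfl

theorem eval_dehom {t : ℕ} (f : (VSub p F t).toSubmodule) (c : ZMod p) :
    (dehom p F t f).eval (ZMod.castHom (dvd_refl p) F c) = evalAt F ![c, 1] f.1 := by
  rw [← Polynomial.coe_aeval_eq_eval, dehom_apply, ← AlgHom.comp_apply, MvPolynomial.comp_aeval,
    evalAt]
  congr 2
  ext1 i
  fin_cases i <;> simp

/-- The linear form `w₀ y - w₁ x`. -/
def linForm (F : Type*) [Field F] [CharP F p] (w : Fin 2 → ZMod p) : MvPolynomial (Fin 2) F :=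
  .C (ZMod.castHom (dvd_refl p) F (w 0)) * .X 1 - .C (ZMod.castHom (dvd_refl p) F (w 1)) * .X 0

theorem linForm_smul (c : ZMod p) (w : Fin 2 → ZMod p) :
    linForm F (c • w) = .C (ZMod.castHom (dvd_refl p) F c) * linForm F w := by
  simp only [linForm, Pi.smul_apply, smul_eq_mul, map_mul]
  ring

theorem isHomogeneous_linForm (w : Fin 2 → ZMod p) : (linForm F w).IsHomogeneous 1 :=
  (MvPolynomial.isHomogeneous_C_mul_X _ _).sub (MvPolynomial.isHomogeneous_C_mul_X _ _)

theorem subst_linForm_mulVec (A : G p) (w : Fin 2 → ZMod p) :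
    subst F A (linForm F (A.1 *ᵥ w)) = linForm F w := by
  have hdet := congrArg (fun c ↦ MvPolynomial.C (σ := Fin 2) (ZMod.castHom (dvd_refl p) F c))
    ((det_fin_two A.1).symm.trans A.2)
  simp only [map_sub, map_mul, map_one] at hdet
  have hC (c : F) : subst F A (.C c) = .C c := MvPolynomial.algHom_C _ _
  simp only [linForm, map_sub, map_mul, hC, subst_X, Fin.sum_univ_two, mulVec, dotProduct, map_add]
  linear_combination (.C (ZMod.castHom (dvd_refl p) F (w 0)) * .X 1 -
    .C (ZMod.castHom (dvd_refl p) F (w 1)) * .X 0) * hdet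

/-- The power `(w₀ y - w₁ x)^(t-1)` as an element of `V_t`. -/
def linFormPow (F : Type*) [Field F] [CharP F p] (t : ℕ) (w : Fin 2 → ZMod p) :
    (VSub p F t).toSubmodule :=
  ⟨linForm F w ^ (t - 1), by
    simpa only [one_mul] using! (isHomogeneous_linForm w).pow (t - 1)⟩

theorem V_linFormPow_mulVec {t : ℕ} (A : G p) (w : Fin 2 → ZMod p) :
    V p F t (op A) (linFormPow F t (A.1 *ᵥ w)) = linFormPow F t w := by
  apply Subtype.ext
  change subst F A (linForm F (A.1 *ᵥ w) ^ (t - 1)) = linForm F w ^ (t - 1)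
  rw [map_pow, subst_linForm_mulVec]

theorem linFormPow_smul {t : ℕ} (c : ZMod p) (w : Fin 2 → ZMod p) :
    linFormPow F t (c • w) = ZMod.castHom (dvd_refl p) F c ^ (t - 1) • linFormPow F t w := by
  apply Subtype.ext
  change linForm F (c • w) ^ (t - 1) = _ • linForm F w ^ (t - 1)
  rw [linForm_smul, mul_pow, ← map_pow, MvPolynomial.smul_eq_C_mul]

/-- The functions on `𝔽_p²` that are homogeneous of degree `d` and vanish at the origin. -/
def homogFun (p : ℕ) (F : Type*) [Field F] [CharP F p] (d : ℕ) :
    Subrepresentation (funRep p F) where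
  toSubmodule :=
    { carrier := {f | f 0 = 0 ∧ ∀ (c : (ZMod p)ˣ) w,
        f (c • w) = ZMod.castHom (dvd_refl p) F c ^ d * f w}
      add_mem' := by
        rintro f h ⟨hf, hf'⟩ ⟨hh, hh'⟩
        exact ⟨by simp [hf, hh], fun c w ↦ by rw [Pi.add_apply, Pi.add_apply, hf', hh', mul_add]⟩
      zero_mem' := ⟨rfl, fun _ _ ↦ (mul_zero _).symm⟩
      smul_mem' := by
        rintro r f ⟨hf, hf'⟩
        exact ⟨by simp [hf], fun c w ↦ by simp only [Pi.smul_apply, hf', mul_smul_comm]⟩ }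
  apply_mem_toSubmodule A f hf :=
    ⟨(congrArg f (mulVec_zero _)).trans hf.1,
      fun c w ↦ (congrArg f (mulVec_smul _ c w)).trans (hf.2 c _)⟩

theorem formToFun_mem_homogFun {t : ℕ} (f : (VSub p F t).toSubmodule) :
    formToFun p F t f ∈ homogFun p F (t - 1) := by
  refine ⟨if_pos rfl, fun c w ↦ ?_⟩
  simp only [formToFun_apply, Units.smul_def, evalAt_smul f.2, mul_ite, mul_zero,
    c.isUnit.smul_eq_zero]

variable [Fact p.Prime]

theorem formToFun_injective {t : ℕ} (ht : 1 ≤ t) (htp : t ≤ p) :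
    Function.Injective (formToFun p F t) := by
  refine (injective_iff_map_eq_zero _).mpr fun f hf ↦ dehom_injective t ?_
  rw [map_zero]
  refine Polynomial.eq_zero_of_degree_lt_of_eval_finset_eq_zero
    (Finset.univ.map ⟨_, (ZMod.castHom (dvd_refl p) F).injective⟩) ?_ fun x hx ↦ ?_
  · rw [Finset.card_map, Finset.card_univ, ZMod.card]
    exact (Polynomial.mem_degreeLT.mp (dehom_mem_degreeLT ht f)).trans_le (Nat.cast_le.mpr htp)
  · obtain ⟨c, -, rfl⟩ := Finset.mem_map.mp hx
    have hc : (![c, 1] : Fin 2 → ZMod p) ≠ 0 := fun h ↦ one_ne_zero (congrFun h 1)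
    exact (eval_dehom f c).trans ((if_neg hc).symm.trans (congrFun hf ![c, 1]))

theorem finrank_homogFun_le (d : ℕ) : Module.finrank F (homogFun p F d).toSubmodule ≤ p + 1 := by
  let point : Option (ZMod p) → Fin 2 → ZMod p := fun o ↦ o.elim ![1, 0] fun c ↦ ![c, 1]
  have hpoint {w : Fin 2 → ZMod p} (hw : w ≠ 0) : ∃ (c : (ZMod p)ˣ) (o : _), w = c • point o := by
    by_cases h1 : w 1 = 0
    · have h0 : w 0 ≠ 0 := fun h0 ↦ hw (funext (Fin.forall_fin_two.mpr ⟨h0, h1⟩))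
      refine ⟨Units.mk0 _ h0, none, funext (Fin.forall_fin_two.mpr ?_)⟩
      simp [point, h1, Units.smul_def]
    · refine ⟨Units.mk0 _ h1, some (w 0 / w 1), funext (Fin.forall_fin_two.mpr ?_)⟩
      simp [point, Units.smul_def, mul_div_cancel₀ _ h1]
  have hinj : Function.Injective
      (LinearMap.funLeft F F point ∘ₗ (homogFun p F d).toSubmodule.subtype) := by
    refine (injective_iff_map_eq_zero _).mpr fun f hf ↦ Subtype.ext (funext fun w ↦ ?_)
    by_cases hw : w = 0
    · exact hw ▸ f.2.1
    · obtain ⟨c, o, rfl⟩ := hpoint hw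
      exact (f.2.2 c _).trans (mul_eq_zero_of_right _ (congrFun hf o))
  have := LinearMap.finrank_le_finrank_of_injective hinj
  rwa [Module.finrank_fintype_fun_eq_card, Fintype.card_option, ZMod.card] at this

theorem sum_castHom_unit_pow (x : (ZMod p)ˣ) :
    ∑ d ∈ Finset.range (p - 1), ZMod.castHom (dvd_refl p) F (x : ZMod p) ^ d =
      if x = 1 then -1 else 0 := by
  split_ifs with hx
  · simp [hx, Nat.cast_sub (Fact.out : p.Prime).one_le]
  · have hne : ZMod.castHom (dvd_refl p) F (x : ZMod p) ≠ 1 := fun h ↦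
      hx (Units.ext ((ZMod.castHom (dvd_refl p) F).injective (h.trans (map_one _).symm)))
    rw [geom_sum_eq hne, ← map_pow, ZMod.pow_card_sub_one_eq_one x.ne_zero, map_one, sub_self,
      zero_div]

/-- The projection of functions on `𝔽_p²` vanishing at the origin to the homogeneous functions of
degree `d`. It averages over the scalars; the sign is the inverse of their number `p - 1`. -/
def homogComponent (p : ℕ) [Fact p.Prime] (F : Type*) [Field F] [CharP F p] (d : ℕ) :
    (funRep p F).IntertwiningMap (funRep p F) where
  toFun f w := -∑ c : (ZMod p)ˣ, ZMod.castHom (dvd_refl p) F (c⁻¹ : (ZMod p)ˣ) ^ d * f (c • w)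
  map_add' f h := by
    ext w
    simp only [Pi.add_apply, mul_add, Finset.sum_add_distrib, neg_add]
  map_smul' r f := by
    ext w
    simp only [Pi.smul_apply, RingHom.id_apply, mul_smul_comm, ← Finset.smul_sum, smul_neg]
  isIntertwining' A := LinearMap.ext fun f ↦ funext fun w ↦ congrArg Neg.neg <|
    Finset.sum_congr rfl fun c _ ↦ congrArg (_ * f ·) (mulVec_smul _ c w)

theorem homogComponent_apply (d : ℕ) (f : (Fin 2 → ZMod p) → F) (w : Fin 2 → ZMod p) :
    homogComponent p F d f w =
      -∑ c : (ZMod p)ˣ, ZMod.castHom (dvd_refl p) F (c⁻¹ : (ZMod p)ˣ) ^ d * f (c • w) := rfl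

theorem homogComponent_mem_homogFun (d : ℕ) {f : (Fin 2 → ZMod p) → F} (hf : f 0 = 0) :
    homogComponent p F d f ∈ homogFun p F d := by
  refine ⟨by simp only [homogComponent_apply, smul_zero, hf, mul_zero, Finset.sum_const_zero,
    neg_zero], fun c w ↦ ?_⟩
  rw [homogComponent_apply, homogComponent_apply, mul_neg, Finset.mul_sum]
  refine congrArg _ (Fintype.sum_equiv (Equiv.mulRight c) _ _ fun e ↦ ?_)
  rw [Equiv.coe_mulRight, ← mul_assoc, ← mul_pow, ← map_mul, ← Units.val_mul, mul_inv,
    mul_comm e⁻¹, mul_inv_cancel_left, mul_smul]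

theorem sum_homogComponent (f : (Fin 2 → ZMod p) → F) :
    ∑ d ∈ Finset.range (p - 1), homogComponent p F d f = f := by
  ext w
  simp only [Finset.sum_apply, homogComponent_apply]
  rw [Finset.sum_neg_distrib, Finset.sum_comm]
  simp only [← Finset.sum_mul, sum_castHom_unit_pow, inv_eq_one, ite_mul, zero_mul,
    Finset.sum_ite_eq', Finset.mem_univ, if_true, one_smul, neg_mul, one_mul, neg_neg]

/-- The map `f ↦ ∑ f (w) (w₀ y - w₁ x)^(t-1)` from functions on `𝔽_p²` to `V_t`. -/
def funToForm (p : ℕ) [Fact p.Prime] (F : Type*) [Field F] [CharP F p] (t : ℕ) :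
    (funRep p F).IntertwiningMap (V p F t) where
  toFun f := ∑ w, f w • linFormPow F t w
  map_add' f h := by simp only [Pi.add_apply, add_smul, Finset.sum_add_distrib]
  map_smul' c f := by
    simp only [Pi.smul_apply, smul_eq_mul, mul_smul, Finset.smul_sum, RingHom.id_apply]
  isIntertwining' A := by
    refine LinearMap.ext fun f ↦ Eq.trans ?_ (map_sum (V p F t A) _ _).symm
    refine Fintype.sum_equiv (SpecialLinearGroup.toLin' A.unop).toEquiv _ _ fun w ↦ ?_
    exact (congrArg _ (V_linFormPow_mulVec A.unop w).symm).trans (map_smul (V p F t A) _ _).symm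

theorem funToForm_apply {t : ℕ} (f : (Fin 2 → ZMod p) → F) :
    funToForm p F t f = ∑ w, f w • linFormPow F t w := rfl

theorem funToForm_homogComponent {d t : ℕ} (hdt : d + t = p) (ht : 1 ≤ t)
    (f : (Fin 2 → ZMod p) → F) : funToForm p F t (homogComponent p F d f) = funToForm p F t f := by
  have hunit (c : (ZMod p)ˣ) : ∑ w, (ZMod.castHom (dvd_refl p) F (c⁻¹ : (ZMod p)ˣ) ^ d *
      f (c • w)) • linFormPow F t w = ∑ w, f w • linFormPow F t w := by
    refine Fintype.sum_equiv (MulAction.toPerm c) _ _ fun w ↦ ?_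
    have hw : linFormPow F t w = ZMod.castHom (dvd_refl p) F (c⁻¹ : (ZMod p)ˣ) ^ (t - 1) •
        linFormPow F t (c • w) := by
      rw [← linFormPow_smul, ← Units.smul_def, inv_smul_smul]
    have hpow : ZMod.castHom (dvd_refl p) F (c⁻¹ : (ZMod p)ˣ) ^ d *
        ZMod.castHom (dvd_refl p) F (c⁻¹ : (ZMod p)ˣ) ^ (t - 1) = 1 := by
      rw [← pow_add, show d + (t - 1) = p - 1 by omega, ← map_pow,
        ZMod.pow_card_sub_one_eq_one (Units.ne_zero _), map_one]
    rw [hw, smul_smul, mul_right_comm, hpow, one_mul]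
    rfl
  calc funToForm p F t (homogComponent p F d f)
    _ = ∑ w, (-1 : F) • ∑ c : (ZMod p)ˣ,
        (ZMod.castHom (dvd_refl p) F (c⁻¹ : (ZMod p)ˣ) ^ d * f (c • w)) • linFormPow F t w :=
      Finset.sum_congr rfl fun w _ ↦ by
        rw [homogComponent_apply, ← neg_one_mul, mul_smul, Finset.sum_smul]
    _ = (-1 : F) • ∑ _c : (ZMod p)ˣ, funToForm p F t f := by
      rw [← Finset.smul_sum, Finset.sum_comm]
      exact congrArg _ (Finset.sum_congr rfl fun c _ ↦ hunit c)
    _ = funToForm p F t f := by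
      rw [Finset.sum_const, Finset.card_univ, ZMod.card_units, ← Nat.cast_smul_eq_nsmul F,
        smul_smul, Nat.cast_pred (Fact.out : p.Prime).pos, CharP.cast_eq_zero, zero_sub,
        neg_mul_neg, one_mul, one_smul]

theorem funToForm_comp_inclusionMap_surjective {d t : ℕ} (hdt : d + t = p) (ht : 1 ≤ t) :
    Function.Surjective ((funToForm p F t).comp (inclusionMap (homogFun p F d))) := by
  have := isIrreducible_V (p := p) (F := F) ht (by omega)
  let f : (Fin 2 → ZMod p) → F := Pi.single ![1, 0] 1
  have hf0 : f 0 = 0 := Pi.single_eq_of_ne (fun h ↦ zero_ne_one (α := ZMod p) (congrFun h 0)) _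
  refine surjective_of_apply_ne_zero _ (v := ⟨_, homogComponent_mem_homogFun d hf0⟩) ?_
  change funToForm p F t (homogComponent p F d f) ≠ 0
  rw [funToForm_homogComponent hdt ht]
  intro h
  rw [funToForm_apply, Fintype.sum_eq_single ![1, 0] fun w hw ↦ by simp [f, hw]] at h
  simp [f, linFormPow, linForm] at h

theorem funToForm_formToFun {s t : ℕ} (ht : 2 ≤ t) (hst : (s - 1) + (t - 1) < 2 * (p - 1))
    (f : (VSub p F s).toSubmodule) : funToForm p F t (formToFun p F s f) = 0 := by
  let Q : MvPolynomial (Fin 2) (MvPolynomial (Fin 2) F) :=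
    MvPolynomial.map MvPolynomial.C f.1 * (.C (.X 1) * .X 0 - .C (.X 0) * .X 1) ^ (t - 1)
  have hQ : Q.IsHomogeneous ((s - 1) + (t - 1)) := by
    have hlin := ((MvPolynomial.isHomogeneous_C_mul_X (.X 1 : MvPolynomial (Fin 2) F)
      (0 : Fin 2)).sub (MvPolynomial.isHomogeneous_C_mul_X (.X 0) 1)).pow (t - 1)
    rw [one_mul] at hlin
    exact (MvPolynomial.IsHomogeneous.map f.2 _).mul hlin
  have hsum := sum_eval_ringHom_comp_eq_zero (K := ZMod p)
    (MvPolynomial.C.comp (ZMod.castHom (dvd_refl p) F))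
    (hQ.totalDegree_le.trans_lt (by rwa [ZMod.card, Fintype.card_fin, mul_comm]))
  refine Subtype.ext ((map_sum (Submodule.subtype _) _ _).trans <|
    Eq.trans (Finset.sum_congr rfl fun w _ ↦ ?_) hsum)
  change formToFun p F s f w • linForm F w ^ (t - 1) = _
  have hmap : MvPolynomial.eval (MvPolynomial.C.comp (ZMod.castHom (dvd_refl p) F) ∘ w)
      (MvPolynomial.map MvPolynomial.C f.1) = .C (σ := Fin 2) (evalAt F w f.1) := by
    rw [MvPolynomial.eval_map, evalAt, MvPolynomial.aeval_def, MvPolynomial.eval₂_comp_left]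
    rfl
  simp only [Q, map_mul, map_pow, map_sub, hmap, MvPolynomial.eval_C, MvPolynomial.eval_X,
    formToFun_apply, MvPolynomial.smul_eq_C_mul]
  by_cases hw : w = 0
  · simp [hw, show t - 1 ≠ 0 by omega]
  · rw [if_neg hw, linForm]
    simp only [Function.comp_apply, RingHom.comp_apply, mul_comm]

theorem exists_formToFun_eq {d t : ℕ} (hdt : d + t = p) (ht : 2 ≤ t)
    {f : (Fin 2 → ZMod p) → F} (hf : f ∈ homogFun p F d) (hf0 : funToForm p F t f = 0) :
    ∃ h, formToFun p F (d + 1) h = f := by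
  have hinj := formToFun_injective (p := p) (F := F) (t := d + 1) (by omega) (by omega)
  obtain ⟨h, hh⟩ := exists_apply_eq_of_finrank_le
    (e := (formToFun p F (d + 1)).toLinearMap.codRestrict (homogFun p F d).toSubmodule
      formToFun_mem_homogFun)
    (q := ((funToForm p F t).comp (inclusionMap (homogFun p F d))).toLinearMap)
    (fun a b hab ↦ hinj (congrArg Subtype.val hab))
    (funToForm_comp_inclusionMap_surjective hdt (by omega))
    (fun h ↦ funToForm_formToFun ht (by omega) h)
    (by
      rw [finrank_VSub (by omega), finrank_VSub (by omega)]
      exact (finrank_homogFun_le d).trans (by omega)) (w := ⟨f, hf⟩) hf0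
  exact ⟨h, congrArg Subtype.val hh⟩

end FunctionsOnPlane

section FrobeniusReciprocity

variable {p : ℕ}

theorem exists_mulVec_eq [Fact p.Prime] {w : Fin 2 → ZMod p} (hw : w ≠ 0) :
    ∃ A : G p, A.1 *ᵥ ![1, 0] = w := by
  by_cases h0 : w 0 = 0
  · have h1 : w 1 ≠ 0 := fun h1 ↦ hw (funext (Fin.forall_fin_two.mpr ⟨h0, h1⟩))
    refine ⟨⟨!![0, -(w 1)⁻¹; w 1, 0], by simp [Matrix.det_fin_two, h1]⟩, ?_⟩
    ext i
    fin_cases i <;> simp [h0]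
  · refine ⟨⟨!![w 0, 0; w 1, (w 0)⁻¹], by simp [Matrix.det_fin_two, h0]⟩, ?_⟩
    ext i
    fin_cases i <;> simp

theorem exists_g_pow_eq_of_mulVec_eq [NeZero p] {A : G p} (h : A.1 *ᵥ ![1, 0] = ![1, 0]) :
    ∃ j : ℕ, (g p ^ j).1 = A := by
  have h00 : A.1 0 0 = 1 := by simpa using congrFun h 0
  have h10 : A.1 1 0 = 0 := by simpa using congrFun h 1
  have htorus : torus p ⟨A, h10⟩ = 1 := Units.ext h00
  refine ⟨(A.1 0 1).val, congrArg Subtype.val (B_ext (b' := ⟨A, h10⟩) ?_ ?_)⟩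
  · rw [map_pow, torus_g, one_pow, htorus]
  · rw [g_pow_apply_zero_one, ZMod.natCast_zmod_val]

theorem coe_mul_mulVec (A A' : G p) (w : Fin 2 → ZMod p) :
    (A * A').1 *ᵥ w = A.1 *ᵥ A'.1 *ᵥ w :=
  (mulVec_mulVec w A.1 A'.1).symm

theorem B_mulVec (b : B p) : b.1.1 *ᵥ ![1, 0] = torus p b • ![1, 0] := by
  have h10 : b.1.1 1 0 = 0 := b.2
  ext i
  fin_cases i <;> simp [h10, torus, Units.smul_def]

variable {F : Type*} [Field F] {P : Type*} [AddCommGroup P] [Module F P]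
  {σ : Representation F (G p)ᵐᵒᵖ P}

theorem factorsThrough_mulVec [NeZero p] {f : Module.Dual F P}
    (hf : ∀ v, f (σ (op (g p).1) v) = f v) (v : P) :
    (fun A : G p ↦ f (σ (op A) v)).FactorsThrough fun A ↦ A.1 *ᵥ ![1, 0] := by
  intro A A' (h : A.1 *ᵥ ![1, 0] = A'.1 *ᵥ ![1, 0])
  have hfix : (A'⁻¹ * A).1 *ᵥ ![1, 0] = ![1, 0] := by
    rw [coe_mul_mulVec, h, ← coe_mul_mulVec, inv_mul_cancel]
    exact one_mulVec _
  obtain ⟨j, hj⟩ := exists_g_pow_eq_of_mulVec_eq hfix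
  have hsemi : Function.Semiconj f (σ (op (g p).1)) id := hf
  calc f (σ (op A) v)
    _ = f (σ (op (g p).1 ^ j) (σ (op A') v)) := by
      rw [← Module.End.mul_apply, ← map_mul, ← op_pow, ← op_mul, ← Subgroup.coe_pow, hj,
        mul_inv_cancel_left]
    _ = f (σ (op A') v) := by
      rw [map_pow, Module.End.pow_apply, hsemi.iterate_right j, Function.iterate_id, id]

/-- The linear form `v ↦ Φ v (1, 0)`. By Frobenius reciprocity for the group generated by `g`, the
stabilizer of `(1, 0)`, every form fixed by `g` arises in this way. -/
def baseForm : σ.IntertwiningMap (funRep p F) →ₗ[F] Module.Dual F P where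
  toFun Φ := LinearMap.proj ![1, 0] ∘ₗ Φ.toLinearMap
  map_add' _ _ := rfl
  map_smul' _ _ := rfl

theorem exists_baseForm_eq [Fact p.Prime] {f : Module.Dual F P}
    (hf : ∀ v, f (σ (op (g p).1) v) = f v) :
    ∃ Φ : σ.IntertwiningMap (funRep p F), (∀ v, Φ v 0 = 0) ∧ baseForm Φ = f := by
  let φ (v : P) : (Fin 2 → ZMod p) → F :=
    (fun A : G p ↦ A.1 *ᵥ ![1, 0]).extend (fun A ↦ f (σ (op A) v)) 0
  have hφ (v : P) (A : G p) : φ v (A.1 *ᵥ ![1, 0]) = f (σ (op A) v) :=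
    (factorsThrough_mulVec hf v).extend_apply 0 A
  have hφ0 (v : P) : φ v 0 = 0 := Function.extend_apply' _ _ _ <| by
    rintro ⟨A, hA⟩
    exact one_ne_zero (congrFun ((mulVec_eq_zero_iff A).mp hA) 0)
  refine ⟨{ toFun := φ, map_add' := fun v v' ↦ ?_, map_smul' := fun c v ↦ ?_,
            isIntertwining' := fun X ↦ LinearMap.ext fun v ↦ ?_ }, hφ0, ?_⟩
  · ext w
    obtain rfl | hw := eq_or_ne w 0
    · simp only [Pi.add_apply, hφ0, add_zero]
    · obtain ⟨A, rfl⟩ := exists_mulVec_eq hw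
      simp only [Pi.add_apply, hφ, map_add]
  · ext w
    obtain rfl | hw := eq_or_ne w 0
    · simp only [Pi.smul_apply, hφ0, smul_zero]
    · obtain ⟨A, rfl⟩ := exists_mulVec_eq hw
      simp only [Pi.smul_apply, hφ, map_smul, RingHom.id_apply]
  · ext w
    change φ (σ X v) w = φ v (X.unop.1 *ᵥ w)
    obtain rfl | hw := eq_or_ne w 0
    · rw [mulVec_zero, hφ0, hφ0]
    · obtain ⟨A, rfl⟩ := exists_mulVec_eq hw
      rw [← coe_mul_mulVec, hφ, hφ, op_mul, op_unop, map_mul, Module.End.mul_apply]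
  · ext v
    have h := hφ v 1
    rw [op_one, map_one] at h
    exact (congrArg (φ v) (one_mulVec _).symm).trans h

theorem eq_zero_of_baseForm_eq_zero [Fact p.Prime] {Φ : σ.IntertwiningMap (funRep p F)}
    (hΦ0 : ∀ v, Φ v 0 = 0) (hΦ : baseForm Φ = 0) : Φ = 0 := by
  refine IntertwiningMap.ext (LinearMap.ext fun v ↦ funext fun w ↦ ?_)
  obtain rfl | hw := eq_or_ne w 0
  · exact hΦ0 v
  · obtain ⟨A, rfl⟩ := exists_mulVec_eq hw
    have h := congrFun (Φ.isIntertwining _ _ (op A) v) ![1, 0]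
    rw [funRep_apply] at h
    exact h.symm.trans (LinearMap.congr_fun hΦ _)

/-- If the values of `Φ` are homogeneous of degree `d`, then `B` acts on `baseForm Φ` through the
`d`-th power of its character `torus`. -/
def baseFormHom [CharP F p] (Φ : σ.IntertwiningMap (funRep p F)) {d : ℕ}
    (hΦ : ∀ v, Φ v ∈ homogFun p F d) : (res σ).IntertwiningMap (charRep p F d) where
  toLinearMap := baseForm Φ
  isIntertwining' b := LinearMap.ext fun v ↦ by
    change Φ (σ (op b.unop.1) v) ![1, 0] = charRep p F d (op b.unop) (Φ v ![1, 0])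
    rw [Φ.isIntertwining _ _, funRep_apply, unop_op, B_mulVec, (hΦ v).2, charRep_apply,
      zpow_natCast]

end FrobeniusReciprocity

section HomsFromProjectiveCover

variable {p : ℕ} {F : Type*} [Field F] [CharP F p] {P : Type*} [AddCommGroup P] [Module F P]
  {σ : Representation F (G p)ᵐᵒᵖ P} {t : ℕ}

theorem natDegree_dehom_eq_zero_of_V_g_eq (ht : 1 ≤ t) (htp : t ≤ p)
    {f : (VSub p F t).toSubmodule} (hf : V p F t (op (g p).1) f = f) :
    (dehom p F t f).natDegree = 0 := by
  by_contra hdeg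
  obtain ⟨n, hn⟩ := Nat.exists_eq_succ_of_ne_zero hdeg
  have hdegree : (dehom p F t f).degree = (n + 1 : ℕ) :=
    (Polynomial.degree_eq_iff_natDegree_eq_of_pos n.succ_pos).mpr hn
  have hlt : n + 1 < t := by
    have h := Polynomial.mem_degreeLT.mp (dehom_mem_degreeLT ht f)
    rwa [hdegree, Nat.cast_lt] at h
  have hcast : ((n + 1 : ℕ) : F) ≠ 0 := fun h ↦
    Nat.not_dvd_of_pos_of_lt n.succ_pos (hlt.trans_le htp) ((CharP.cast_eq_zero_iff F p _).mp h)
  have h := degree_taylor_one_sub_self hdegree hcast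
  rw [← dehom_V_g, hf, sub_self, Polynomial.degree_zero] at h
  exact WithBot.bot_ne_natCast n h

variable {π : σ.IntertwiningMap (V p F t)}

/- Over an arbitrary field of characteristic `p`, Schur's lemma for `V_t` holds because the vectors
of `V_t` fixed by `g` form a line. -/
theorem IsEssentialEpi.exists_eq_smul (hπ : IsEssentialEpi π) (ht : 1 ≤ t) (htp : t ≤ p)
    (ψ : σ.IntertwiningMap (V p F t)) : ∃ c : F, ψ = c • π := by
  have := isIrreducible_V (F := F) ht htp
  obtain rfl | hψ := eq_or_ne ψ 0
  · exact ⟨0, (zero_smul F π).symm⟩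
  have hone : dehom p F t (homog p t 1) = 1 :=
    dehom_homog ht (Polynomial.mem_degreeLT.mpr (by simpa using Nat.pos_of_ne_zero (by omega)))
  obtain ⟨v, hv⟩ := hπ.1 (homog p t 1)
  have hπv : π (σ (op (g p).1) v - v) = 0 := by
    rw [map_sub, π.isIntertwining _ _, sub_eq_zero, hv]
    exact dehom_injective t (by rw [dehom_V_g, hone, Polynomial.taylor_one, map_one])
  have hψv : V p F t (op (g p).1) (ψ v) = ψ v := by
    have h : σ (op (g p).1) v - v ∈ ψ.ker := (hπ.ker_eq_ker_of_ne_zero hψ).ge hπv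
    rwa [← ψ.isIntertwining _ _, ← sub_eq_zero, ← map_sub]
  let c := (dehom p F t (ψ v)).coeff 0
  have hcv : (ψ - c • π) v = 0 := by
    refine sub_eq_zero.mpr (dehom_injective t ?_)
    change dehom p F t (ψ v) = dehom p F t (c • π v)
    rw [map_smul, hv, hone, Polynomial.smul_eq_C_mul, mul_one]
    exact Polynomial.eq_C_of_natDegree_eq_zero (natDegree_dehom_eq_zero_of_V_g_eq ht htp hψv)
  refine ⟨c, sub_eq_zero.mp (by_contra fun hne ↦ ?_)⟩
  have hv0 : π v = 0 := (hπ.ker_eq_ker_of_ne_zero hne).le hcv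
  rw [← hv, hv0, map_zero] at hone
  exact zero_ne_one hone

theorem IsEssentialEpi.eq_zero_of_ne (hπ : IsEssentialEpi π) (ht : 1 ≤ t) (htp : t ≤ p) {s : ℕ}
    (hs : 1 ≤ s) (hsp : s ≤ p) (hst : s ≠ t) (ψ : σ.IntertwiningMap (V p F s)) : ψ = 0 := by
  have := isIrreducible_V (F := F) ht htp
  have := isIrreducible_V (F := F) hs hsp
  have := finite_VSub (p := p) (F := F) ht
  by_contra hψ
  have hrank := hπ.finrank_eq_of_ne_zero hψ
  rw [finrank_VSub hs, finrank_VSub ht] at hrank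
  exact hst hrank

variable [Fact p.Prime] {S : Submodule F (σ.IntertwiningMap (funRep p F))}

theorem IsEssentialEpi.mem_of_funToForm_comp_eq_zero (hπ : IsEssentialEpi π) (ht : 1 ≤ t)
    (htp : t ≤ p) (hS : t < p → (formToFun p F t).comp π ∈ S) {d s : ℕ} (hds : d + s = p)
    (hs : 2 ≤ s) {Φ : σ.IntertwiningMap (funRep p F)} (hΦ : ∀ v, Φ v ∈ homogFun p F d)
    (hΦ0 : (funToForm p F s).comp Φ = 0) : Φ ∈ S := by
  have hinj := formToFun_injective (p := p) (F := F) (t := d + 1) (by omega) (by omega)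
  obtain ⟨ψ, rfl⟩ := exists_comp_eq_of_injective hinj Φ fun v ↦
    exists_formToFun_eq hds hs (hΦ v) (DFunLike.congr_fun hΦ0 v)
  obtain rfl | hdt := eq_or_ne (d + 1) t
  · obtain ⟨c, rfl⟩ := hπ.exists_eq_smul ht htp ψ
    rw [IntertwiningMap.comp_smul]
    exact S.smul_mem c (hS (by omega))
  · rw [hπ.eq_zero_of_ne ht htp (by omega) (by omega) hdt ψ]
    convert S.zero_mem
    exact IntertwiningMap.ext (LinearMap.comp_zero _)

theorem IsEssentialEpi.mem_of_mem_homogFun (hπ : IsEssentialEpi π) (ht : 1 ≤ t) (htp : t ≤ p)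
    (hS₁ : t < p → (formToFun p F t).comp π ∈ S)
    (hS₂ : 2 ≤ t → ∃ Ψ ∈ S, (∀ v, Ψ v ∈ homogFun p F (p - t)) ∧ (funToForm p F t).comp Ψ = π)
    {d s : ℕ} (hds : d + s = p) (hs : 2 ≤ s) {Φ : σ.IntertwiningMap (funRep p F)}
    (hΦ : ∀ v, Φ v ∈ homogFun p F d) : Φ ∈ S := by
  obtain rfl | hst := eq_or_ne s t
  · obtain rfl : d = p - s := by omega
    obtain ⟨Ψ, hΨS, hΨ, hΨπ⟩ := hS₂ hs
    obtain ⟨c, hc⟩ := hπ.exists_eq_smul ht htp ((funToForm p F s).comp Φ)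
    have hdiff : Φ - c • Ψ ∈ S := by
      refine hπ.mem_of_funToForm_comp_eq_zero ht htp hS₁ hds hs
        (fun v ↦ (homogFun p F _).toSubmodule.sub_mem (hΦ v) (Submodule.smul_mem _ c (hΨ v))) ?_
      refine IntertwiningMap.ext (LinearMap.ext fun v ↦ ?_)
      have hcv : funToForm p F s (Φ v) = c • π v := DFunLike.congr_fun hc v
      have hΨv : funToForm p F s (Ψ v) = π v := DFunLike.congr_fun hΨπ v
      change funToForm p F s (Φ v - c • Ψ v) = 0
      rw [map_sub, map_smul, hcv, hΨv, sub_self]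
    exact (S.sub_mem_iff_left (S.smul_mem c hΨS)).mp hdiff
  · exact hπ.mem_of_funToForm_comp_eq_zero ht htp hS₁ hds hs hΦ
      (hπ.eq_zero_of_ne ht htp (by omega) (by omega) hst _)

theorem sum_homogComponent_comp (Φ : σ.IntertwiningMap (funRep p F)) :
    ∑ d ∈ Finset.range (p - 1), (homogComponent p F d).comp Φ = Φ := by
  refine IntertwiningMap.ext (LinearMap.ext fun v ↦ ?_)
  exact (IntertwiningMap.sum_apply _ _ _ _ v).trans (sum_homogComponent (Φ v))

theorem IsEssentialEpi.mem_map_baseForm (hπ : IsEssentialEpi π) (ht : 1 ≤ t) (htp : t ≤ p)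
    (hS₁ : t < p → (formToFun p F t).comp π ∈ S)
    (hS₂ : 2 ≤ t → ∃ Ψ ∈ S, (∀ v, Ψ v ∈ homogFun p F (p - t)) ∧ (funToForm p F t).comp Ψ = π)
    {f : Module.Dual F P} (hf : ∀ v, f (σ (op (g p).1) v) = f v) : f ∈ S.map baseForm := by
  obtain ⟨Φ, hΦ0, hΦf⟩ := exists_baseForm_eq hf
  refine ⟨Φ, ?_, hΦf⟩
  rw [← sum_homogComponent_comp Φ]
  refine S.sum_mem fun d hd ↦ ?_
  have hd := Finset.mem_range.mp hd
  exact hπ.mem_of_mem_homogFun ht htp hS₁ hS₂ (s := p - d) (by omega) (by omega)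
    fun v ↦ homogComponent_mem_homogFun d (hΦ0 v)

theorem exists_lift_homogFun (hσ : Module.Projective (MonoidAlgebra F (G p)ᵐᵒᵖ) σ.asModule)
    {d : ℕ} (hdt : d + t = p) (ht : 1 ≤ t) (π : σ.IntertwiningMap (V p F t)) :
    ∃ Ψ : σ.IntertwiningMap (funRep p F),
      (∀ v, Ψ v ∈ homogFun p F d) ∧ (funToForm p F t).comp Ψ = π := by
  obtain ⟨k, hk⟩ := exists_lift hσ _ (funToForm_comp_inclusionMap_surjective hdt ht) π
  exact ⟨(inclusionMap (homogFun p F d)).comp k, fun v ↦ (k v).2,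
    IntertwiningMap.ext (LinearMap.ext hk)⟩

theorem linearIndependent_baseForm [(V p F t).IsIrreducible] (hπ : Function.Surjective π)
    (ht : 2 ≤ t) (htp : t < p) {Ψ : σ.IntertwiningMap (funRep p F)} (hΨ0 : ∀ v, Ψ v 0 = 0)
    (hΨπ : (funToForm p F t).comp Ψ = π) :
    LinearIndependent F ![baseForm ((formToFun p F t).comp π), baseForm Ψ] := by
  obtain ⟨x, hx⟩ := exists_ne_zero_of_isIrreducible (V p F t)
  obtain ⟨v, rfl⟩ := hπ x
  refine LinearIndependent.pair_iff.mpr fun a b hab ↦ ?_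
  rw [← map_smul, ← map_smul, ← map_add] at hab
  have hzero : a • formToFun p F t (π v) + b • Ψ v = 0 :=
    DFunLike.congr_fun (eq_zero_of_baseForm_eq_zero (fun w ↦ by
      change a • formToFun p F t (π w) 0 + b • Ψ w 0 = 0
      rw [hΨ0, formToFun_apply, if_pos rfl, smul_zero, smul_zero, add_zero]) hab) v
  have hb : b = 0 := by
    have h := congrArg (funToForm p F t) hzero
    rw [map_add, map_smul, map_smul, map_zero, funToForm_formToFun ht (by omega), smul_zero,
      zero_add] at h
    exact (smul_eq_zero.mp h).resolve_right fun h0 ↦ hx ((DFunLike.congr_fun hΨπ v).symm.trans h0)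
  rw [hb, zero_smul, add_zero, ← map_smul] at hzero
  have h := formToFun_injective (by omega) htp.le (hzero.trans (map_zero _).symm)
  exact ⟨(smul_eq_zero.mp h).resolve_right hx, hb⟩

end HomsFromProjectiveCover

section RestrictionToBorel

variable {p : ℕ} {F : Type*} [Field F] {P : Type*} [AddCommGroup P] [Module F P]
  {σ : Representation F (G p)ᵐᵒᵖ P}

theorem surjective_prod_of_linearIndependent {f₁ f₂ : Module.Dual F P}
    (h : LinearIndependent F ![f₁, f₂]) : Function.Surjective (f₁.prod f₂) := by
  refine LinearMap.dualMap_injective_iff.mp ((injective_iff_map_eq_zero _).mpr fun l hl ↦ ?_)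
  have hl_apply (x y : F) : l (x, y) = l (1, 0) * x + l (0, 1) * y := by
    rw [mul_comm, mul_comm _ y, ← smul_eq_mul, ← smul_eq_mul, ← map_smul, ← map_smul, ← map_add]
    simp
  have hcomb : l (1, 0) • f₁ + l (0, 1) • f₂ = 0 :=
    LinearMap.ext fun v ↦ (hl_apply (f₁ v) (f₂ v)).symm.trans (LinearMap.congr_fun hl v)
  obtain ⟨h₁, h₂⟩ := LinearIndependent.pair_iff.mp h _ _ hcomb
  refine LinearMap.ext fun x ↦ ?_
  rw [← Prod.mk.eta (p := x), hl_apply, h₁, h₂, zero_mul, zero_mul, add_zero, LinearMap.zero_apply]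

theorem op_subtype_B_injective : Function.Injective (MonoidHom.op (B p).subtype) :=
  fun _ _ h ↦ unop_injective (Subtype.ext (op_injective h))

variable [Fact p.Prime] [CharP F p] {ζ : (ZMod p)ˣ}

theorem nonempty_res_equiv_of_span_singleton [Module.Finite F P]
    (hζ : ∀ x : (ZMod p)ˣ, x ∈ Subgroup.zpowers ζ)
    (hσ : Module.Projective (MonoidAlgebra F (G p)ᵐᵒᵖ) σ.asModule)
    {Φ : σ.IntertwiningMap (funRep p F)} {d : ℕ} (hΦ : ∀ v, Φ v ∈ homogFun p F d)
    (hne : baseForm Φ ≠ 0)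
    (hspan : ∀ f : Module.Dual F P, (∀ v, f (σ (op (g p).1) v) = f v) →
      f ∈ (Submodule.span F {Φ}).map baseForm)
    {M : Type*} [AddCommGroup M] [Module F M] {ρ : Representation F (B p)ᵐᵒᵖ M}
    (hρ : IsU ζ d p ρ) : Nonempty ((res σ).Equiv ρ) := by
  obtain ⟨τ, hτ⟩ := hρ.exists_isEssentialEpi_charRep hζ
  refine nonempty_equiv_of_surjective op_subtype_B_injective hσ hτ (baseFormHom Φ hΦ)
    (LinearMap.surjective hne) ?_
  have hrank := finrank_le_mul_finrank_of_invariant_mem (res σ) (k := op (g p))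
    (by rw [← op_pow, g_pow_p, op_one]) _ hspan
  rwa [Submodule.map_span, Set.image_singleton, finrank_span_singleton hne, mul_one,
    ← hρ.2.1] at hrank

theorem nonempty_res_equiv_prod_of_span_pair [Module.Finite F P]
    (hζ : ∀ x : (ZMod p)ˣ, x ∈ Subgroup.zpowers ζ)
    (hσ : Module.Projective (MonoidAlgebra F (G p)ᵐᵒᵖ) σ.asModule)
    {Φ₁ Φ₂ : σ.IntertwiningMap (funRep p F)} {d₁ d₂ : ℕ} (hΦ₁ : ∀ v, Φ₁ v ∈ homogFun p F d₁)
    (hΦ₂ : ∀ v, Φ₂ v ∈ homogFun p F d₂)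
    (hind : LinearIndependent F ![baseForm Φ₁, baseForm Φ₂])
    (hspan : ∀ f : Module.Dual F P, (∀ v, f (σ (op (g p).1) v) = f v) →
      f ∈ (Submodule.span F {Φ₁, Φ₂}).map baseForm)
    {M₁ M₂ : Type*} [AddCommGroup M₁] [Module F M₁] [AddCommGroup M₂] [Module F M₂]
    {ρ₁ : Representation F (B p)ᵐᵒᵖ M₁} {ρ₂ : Representation F (B p)ᵐᵒᵖ M₂}
    (hρ₁ : IsU ζ d₁ p ρ₁) (hρ₂ : IsU ζ d₂ p ρ₂) : Nonempty ((res σ).Equiv (ρ₁.prod ρ₂)) := by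
  obtain ⟨τ₁, hτ₁⟩ := hρ₁.exists_isEssentialEpi_charRep hζ
  obtain ⟨τ₂, hτ₂⟩ := hρ₂.exists_isEssentialEpi_charRep hζ
  refine nonempty_equiv_of_surjective op_subtype_B_injective hσ (hτ₁.prodMap hτ₂)
    ((baseFormHom Φ₁ hΦ₁).prod (baseFormHom Φ₂ hΦ₂)) (surjective_prod_of_linearIndependent hind) ?_
  have hrank := finrank_le_mul_finrank_of_invariant_mem (res σ) (k := op (g p))
    (by rw [← op_pow, g_pow_p, op_one]) _ hspan
  have : Module.Finite F M₁ := Module.finite_of_finrank_pos (by rw [hρ₁.2.1]; exact NeZero.pos p)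
  have : Module.Finite F M₂ := Module.finite_of_finrank_pos (by rw [hρ₂.2.1]; exact NeZero.pos p)
  rw [Submodule.map_span, Set.image_pair, ← Matrix.range_cons_cons_empty _ _ ![],
    finrank_span_eq_card hind, Fintype.card_fin] at hrank
  rw [Module.finrank_prod, hρ₁.2.1, hρ₂.2.1]
  omega

theorem IsProjectiveCover.nonempty_res_equiv_of_one
    (hζ : ∀ x : (ZMod p)ˣ, x ∈ Subgroup.zpowers ζ) (hσ : IsProjectiveCover σ (V p F 1))
    {M : Type*} [AddCommGroup M] [Module F M] {ρ : Representation F (B p)ᵐᵒᵖ M}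
    (hρ : IsU ζ 0 p ρ) : Nonempty ((res σ).Equiv ρ) := by
  obtain ⟨hproj, π, hπ⟩ : _ ∧ ∃ π : σ.IntertwiningMap (V p F 1), IsEssentialEpi π := hσ
  have hp := (Fact.out : p.Prime).one_le
  have := isIrreducible_V (F := F) le_rfl hp
  have : Finite (G p)ᵐᵒᵖ := .of_equiv (G p) opEquiv
  have := hπ.finite
  have hmem (v : P) : formToFun p F 1 (π v) ∈ homogFun p F 0 := formToFun_mem_homogFun (π v)
  refine nonempty_res_equiv_of_span_singleton hζ hproj (Φ := (formToFun p F 1).comp π) hmem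
    (fun h0 ↦ ?_) (fun f hf ↦ hπ.mem_map_baseForm le_rfl hp
      (fun _ ↦ Submodule.mem_span_singleton_self _) (by omega) hf) hρ
  obtain ⟨x, hx⟩ := exists_ne_zero_of_isIrreducible (V p F 1)
  obtain ⟨v, rfl⟩ := hπ.1 x
  have hv := DFunLike.congr_fun (eq_zero_of_baseForm_eq_zero (fun w ↦ (hmem w).1) h0) v
  exact hx (formToFun_injective le_rfl hp (hv.trans (map_zero _).symm))

theorem IsProjectiveCover.nonempty_res_equiv_of_prime
    (hζ : ∀ x : (ZMod p)ˣ, x ∈ Subgroup.zpowers ζ) (hσ : IsProjectiveCover σ (V p F p))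
    {M : Type*} [AddCommGroup M] [Module F M] {ρ : Representation F (B p)ᵐᵒᵖ M}
    (hρ : IsU ζ 0 p ρ) : Nonempty ((res σ).Equiv ρ) := by
  obtain ⟨hproj, π, hπ⟩ : _ ∧ ∃ π : σ.IntertwiningMap (V p F p), IsEssentialEpi π := hσ
  have hp := (Fact.out : p.Prime).one_le
  have := isIrreducible_V (F := F) hp le_rfl
  have : Finite (G p)ᵐᵒᵖ := .of_equiv (G p) opEquiv
  have := hπ.finite
  obtain ⟨Ψ, hΨ, hΨπ⟩ := exists_lift_homogFun hproj (zero_add p) hp π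
  refine nonempty_res_equiv_of_span_singleton hζ hproj hΨ (fun h0 ↦ ?_)
    (fun f hf ↦ hπ.mem_map_baseForm hp le_rfl (fun h ↦ (lt_irrefl p h).elim)
      (fun _ ↦ ⟨Ψ, Submodule.mem_span_singleton_self _, by rwa [Nat.sub_self], hΨπ⟩) hf) hρ
  obtain ⟨x, hx⟩ := exists_ne_zero_of_isIrreducible (V p F p)
  obtain ⟨v, rfl⟩ := hπ.1 x
  have hv := DFunLike.congr_fun (eq_zero_of_baseForm_eq_zero (fun w ↦ (hΨ w).1) h0) v
  exact hx ((DFunLike.congr_fun hΨπ v).symm.trans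
    ((congrArg (funToForm p F p) hv).trans (map_zero _)))

theorem IsProjectiveCover.nonempty_res_equiv_prod
    (hζ : ∀ x : (ZMod p)ˣ, x ∈ Subgroup.zpowers ζ) {t : ℕ} (ht : 1 < t) (htp : t < p)
    (hσ : IsProjectiveCover σ (V p F t))
    {M₁ M₂ : Type*} [AddCommGroup M₁] [Module F M₁] [AddCommGroup M₂] [Module F M₂]
    {ρ₁ : Representation F (B p)ᵐᵒᵖ M₁} {ρ₂ : Representation F (B p)ᵐᵒᵖ M₂}
    (hρ₁ : IsU ζ (t - 1) p ρ₁) (hρ₂ : IsU ζ (p - t) p ρ₂) :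
    Nonempty ((res σ).Equiv (ρ₁.prod ρ₂)) := by
  obtain ⟨hproj, π, hπ⟩ : _ ∧ ∃ π : σ.IntertwiningMap (V p F t), IsEssentialEpi π := hσ
  have := isIrreducible_V (F := F) ht.le htp.le
  have : Finite (G p)ᵐᵒᵖ := .of_equiv (G p) opEquiv
  have := hπ.finite
  obtain ⟨Ψ, hΨ, hΨπ⟩ := exists_lift_homogFun hproj (Nat.sub_add_cancel htp.le) ht.le π
  rw [← Nat.cast_pred (zero_lt_one.trans ht)] at hρ₁
  rw [← Nat.cast_sub htp.le] at hρ₂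
  exact nonempty_res_equiv_prod_of_span_pair hζ hproj (Φ₁ := (formToFun p F t).comp π)
    (fun v ↦ formToFun_mem_homogFun (π v)) hΨ
    (linearIndependent_baseForm hπ.1 ht htp (fun v ↦ (hΨ v).1) hΨπ)
    (fun f hf ↦ hπ.mem_map_baseForm ht.le htp.le
      (fun _ ↦ Submodule.subset_span (Set.mem_insert _ _))
      (fun _ ↦ ⟨Ψ, Submodule.subset_span (Set.mem_insert_of_mem _ (Set.mem_singleton Ψ)),
        hΨ, hΨπ⟩) hf) hρ₁ hρ₂

end RestrictionToBorel
end
end SL2Rep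

theorem mainTheorem8_general {p : ℕ} [Fact p.Prime]
    {F : Type u} [Field F] [CharP F p]
    (ζ : (ZMod p)ˣ) (hζ : ∀ x : (ZMod p)ˣ, x ∈ Subgroup.zpowers ζ)
    (t : ℕ) (ht1 : 1 ≤ t) (htp : t ≤ p) :
    (∃ (P : Type u) (_ : AddCommGroup P) (_ : Module F P)
      (σ : Representation F (SL2Rep.G p)ᵐᵒᵖ P),
      SL2Rep.IsProjectiveCover σ (SL2Rep.V p F t)) ∧
    (∀ a : ℤ, ∃ (M : Type u) (_ : AddCommGroup M) (_ : Module F M)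
      (ρ : Representation F (SL2Rep.B p)ᵐᵒᵖ M), SL2Rep.IsU ζ a p ρ) ∧
    ∀ (P : Type v) [AddCommGroup P] [Module F P]
      (σ : Representation F (SL2Rep.G p)ᵐᵒᵖ P),
      SL2Rep.IsProjectiveCover σ (SL2Rep.V p F t) →
      ((t = 1 ∨ t = p) →
        ∀ (M : Type w) [AddCommGroup M] [Module F M]
          (ρ : Representation F (SL2Rep.B p)ᵐᵒᵖ M),
          SL2Rep.IsU ζ 0 p ρ → Nonempty ((SL2Rep.res σ).Equiv ρ)) ∧
      ((1 < t ∧ t < p) →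
        ∀ (M₁ : Type w) [AddCommGroup M₁] [Module F M₁]
          (ρ₁ : Representation F (SL2Rep.B p)ᵐᵒᵖ M₁)
          (M₂ : Type w) [AddCommGroup M₂] [Module F M₂]
          (ρ₂ : Representation F (SL2Rep.B p)ᵐᵒᵖ M₂),
          SL2Rep.IsU ζ ((t : ℤ) - 1) p ρ₁ → SL2Rep.IsU ζ ((p : ℤ) - t) p ρ₂ →
          Nonempty ((SL2Rep.res σ).Equiv (ρ₁.prod ρ₂))) := by
  have : Finite (SL2Rep.G p)ᵐᵒᵖ := .of_equiv (SL2Rep.G p) opEquiv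
  have := SL2Rep.isIrreducible_V (F := F) ht1 htp
  refine ⟨SL2Rep.exists_isProjectiveCover (SL2Rep.V p F t), fun a ↦ ?_, fun P _ _ σ hσ ↦ ⟨?_, ?_⟩⟩
  · exact ⟨_, _, _, SL2Rep.uniserialRep p F a p,
      SL2Rep.isU_uniserialRep ζ a (Fact.out : p.Prime).one_le le_rfl⟩
  · rintro (rfl | rfl) M _ _ ρ hρ
    · exact hσ.nonempty_res_equiv_of_one hζ hρ
    · exact hσ.nonempty_res_equiv_of_prime hζ hρ
  · rintro ⟨h1t, htp'⟩ _ _ _ _ _ _ _ _ hρ₁ hρ₂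
    exact hσ.nonempty_res_equiv_prod hζ h1t htp' hρ₁ hρ₂

theorem mainTheorem8 {p : ℕ} [Fact p.Prime] (hp : p ≠ 2)
    {F : Type u} [Field F] [IsAlgClosed F] [CharP F p]
    (ζ : (ZMod p)ˣ) (hζ : ∀ x : (ZMod p)ˣ, x ∈ Subgroup.zpowers ζ)
    (t : ℕ) (ht1 : 1 ≤ t) (htp : t ≤ p) :
    -- the projective cover of `V_t` and the modules `U_{a,p}` exist
    (∃ (P : Type u) (_ : AddCommGroup P) (_ : Module F P)
      (σ : Representation F (SL2Rep.G p)ᵐᵒᵖ P),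
      SL2Rep.IsProjectiveCover σ (SL2Rep.V p F t)) ∧
    (∀ a : ℤ, ∃ (M : Type u) (_ : AddCommGroup M) (_ : Module F M)
      (ρ : Representation F (SL2Rep.B p)ᵐᵒᵖ M), SL2Rep.IsU ζ a p ρ) ∧
    -- the restriction of the projective cover
    ∀ (P : Type v) [AddCommGroup P] [Module F P]
      (σ : Representation F (SL2Rep.G p)ᵐᵒᵖ P),
      SL2Rep.IsProjectiveCover σ (SL2Rep.V p F t) →
      ((t = 1 ∨ t = p) →
        ∀ (M : Type w) [AddCommGroup M] [Module F M]
          (ρ : Representation F (SL2Rep.B p)ᵐᵒᵖ M),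
          SL2Rep.IsU ζ 0 p ρ → Nonempty ((SL2Rep.res σ).Equiv ρ)) ∧
      ((1 < t ∧ t < p) →
        ∀ (M₁ : Type w) [AddCommGroup M₁] [Module F M₁]
          (ρ₁ : Representation F (SL2Rep.B p)ᵐᵒᵖ M₁)
          (M₂ : Type w) [AddCommGroup M₂] [Module F M₂]
          (ρ₂ : Representation F (SL2Rep.B p)ᵐᵒᵖ M₂),
          SL2Rep.IsU ζ ((t : ℤ) - 1) p ρ₁ → SL2Rep.IsU ζ ((p : ℤ) - t) p ρ₂ →
          Nonempty ((SL2Rep.res σ).Equiv (ρ₁.prod ρ₂))) := by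
  exact mainTheorem8_general ζ hζ t ht1 htp
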